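/- A signed simple graph $(G,\sigma)$ is a finite simple graph $G$ with an assignment $\sigma:E(G)\to\{+,-\}$. Switching a set $X\subseteq V(G)$ means reversing the signs of all edges between $X$ and $V(G)\setminus X$; two signed graphs are switching isomorphic if, after switching some set of vertices of one of them, there is a bijection between their vertex sets that preserves adjacency, non-adjacency and signs. $(K_4,-)$ is the complete graph on 4 vertices with all edges negative. For integers $p\ge 2q>0$ with $p$ even, $K^s_{p;q}$ is the signed graph on $\{0,1,\dots,p-1\}$ (with loops, and possibly with two parallel edges of opposite signs) in which $ij$ is a negative edge if and only if $q\le|i-j|\le p-q$, and $ij$ is a positive edge if and only if $|i-j|\le \frac p2-q$ or $|i-j|\ge\frac p2+q$. A circular $\frac pq$-coloring of $(G,\sigma)$ is a map $V(G)\to\{0,\dots,p-1\}$ that sends each edge of $G$ to an edge of the same sign of $K^s_{p;q}$, and the circular chromatic number $\chi_c(G,\sigma)$ is the infimum of all $\frac pq$ such that $(G,\sigma)$ admits a circular $\frac pq$-coloring. **Theorem.** (1) Let $(G,\sigma)$ be a connected signed simple graph of maximum degree $3$ that is not switching isomorphic to $(K_4,-)$. Then $\chi_c(G,\sigma)\le\frac{10}{3}$.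 (2) Every signed simple graph of maximum degree at most $3$ in which no connected component is switching isomorphic to $(K_4,-)$ admits a circular $\frac{10}{3}$-coloring (that is, with $p=10$ and $q=3$). -/

import Mathlib

open scoped ENNReal

/-- A signed graph on the vertex set `V`, with signs in `ℤˣ = {1, -1}`; `edge s u v` says that
there is an edge of sign `s` joining `u` and `v`. Loops are allowed, and so are two parallel edges
of opposite signs. (Parallel edges of the same sign play no role for homomorphisms.) -/
structure SignedGraph (V : Type*) where
  edge : ℤˣ → V → V → Prop
  symm : ∀ s u v, edge s u v → edge s v u

namespace SignedGraph

/-- The signed simple graph `(G, σ)`. -/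
def ofSimple {V : Type*} (G : SimpleGraph V) (σ : G.edgeSet → ℤˣ) : SignedGraph V where
  edge s u v := ∃ h : G.Adj u v, σ ⟨s(u, v), h⟩ = s
  symm := by
    rintro s u v ⟨h, rfl⟩
    refine ⟨h.symm, congrArg σ (Subtype.ext ?_)⟩
    exact Sym2.eq_swap

/-- Switching a set `X` of vertices: the edges between `X` and its complement change sign. -/
def switch {V : Type*} (Γ : SignedGraph V) (X : Set V) : SignedGraph V where
  edge s u v := ((u ∈ X ↔ v ∈ X) ∧ Γ.edge s u v) ∨ (¬(u ∈ X ↔ v ∈ X) ∧ Γ.edge (-s) u v)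
  symm := by
    rintro s u v (⟨h, e⟩ | ⟨h, e⟩)
    · exact Or.inl ⟨h.symm, Γ.symm _ _ _ e⟩
    · exact Or.inr ⟨fun h' => h h'.symm, Γ.symm _ _ _ e⟩

/-- The signed subgraph induced by a set `S` of vertices. -/
def induce {V : Type*} (Γ : SignedGraph V) (S : Set V) : SignedGraph S where
  edge s u v := Γ.edge s u v
  symm s u v := Γ.symm s u v

/-- Switching isomorphism: after switching some set of vertices of the first signed graph, there
is a bijection of the vertices that preserves adjacency, non-adjacency and signs. -/
def SwitchingIsomorphic {V W : Type*} (Γ : SignedGraph V) (Λ : SignedGraph W) : Prop :=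
  ∃ (X : Set V) (f : V ≃ W), ∀ s u v, (Γ.switch X).edge s u v ↔ Λ.edge s (f u) (f v)

/-- Existence of an edge-sign preserving homomorphism (no switching). -/
def SPHom {V W : Type*} (Γ : SignedGraph V) (Λ : SignedGraph W) : Prop :=
  ∃ f : V → W, ∀ s u v, Γ.edge s u v → Λ.edge s (f u) (f v)

/-- `(K_n, -)`: the complete graph on `n` vertices with all edges negative. -/
def negComplete (n : ℕ) : SignedGraph (Fin n) :=
  ofSimple ⊤ fun _ => -1

/-- The signed circular clique `K^s_{p;q}` on the vertex set `{0, …, p-1}`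
(meant for `p` even and `p ≥ 2q > 0`): `ij` is a negative edge iff `q ≤ |i-j| ≤ p-q`, and a
positive edge iff `|i-j| ≤ p/2 - q` or `|i-j| ≥ p/2 + q`. -/
def circularClique (p q : ℕ) : SignedGraph (Fin p) where
  edge s i j :=
    (s = -1 ∧ (q : ℤ) ≤ |(i : ℤ) - (j : ℤ)| ∧ |(i : ℤ) - (j : ℤ)| ≤ (p : ℤ) - q) ∨
    (s = 1 ∧ (|(i : ℤ) - (j : ℤ)| ≤ (p : ℤ) / 2 - q ∨ (p : ℤ) / 2 + q ≤ |(i : ℤ) - (j : ℤ)|))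
  symm s i j h := by rwa [abs_sub_comm (j : ℤ) (i : ℤ)]

/-- `Γ` admits a circular `p/q`-coloring, where `p` is even and `p ≥ 2q > 0`. -/
def AdmitsCircularColoring {V : Type*} (Γ : SignedGraph V) (p q : ℕ) : Prop :=
  0 < q ∧ Even p ∧ 2 * q ≤ p ∧ Γ.SPHom (circularClique p q)

/-- The circular chromatic number, an infimum in `[0, ∞]` (so that it is `∞` and not `0` if there
is no circular coloring at all). -/
noncomputable def circularChromaticNumber {V : Type*} (Γ : SignedGraph V) : ℝ≥0∞ :=
  sInf {r | ∃ p q : ℕ, Γ.AdmitsCircularColoring p q ∧ r = (p : ℝ≥0∞) / (q : ℝ≥0∞)}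

end SignedGraph

/-!
Place the ten colours on the circle `ZMod 10`. The ends of a positive edge need colours at distance
at most two, those of a negative edge colours of which one is at distance at most two from the
antipode of the other. So each coloured neighbour restricts the colours of a vertex to a half circle
of five consecutive colours, whose middle is called a centre below, and switching a vertex amounts
to replacing its colour by the antipode.

Among signed simple graphs of maximum degree at most three without a `K₄` all of whose triangles are
negative (`IsGood`), consider a counterexample with a minimal set of vertices of positive degree. A
piece of it is deleted, the rest is coloured, possibly after adding edges that control the colours
of the vertices to which the piece is attached, and the piece is coloured last. Whether this last
step succeeds is a finite question about the circle of colours.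

* Positive triangles, diamonds (two triangles with a common edge) and negative cycles of length four
  can be coloured whatever the colours outside (`exists_positive_triangle`,
  `exists_negative_diamond`, `exists_negative_square`).
* A negative triangle can be coloured if two of its centres are far apart, which an additional edge
  between two outer neighbours achieves. If no such edge can be added, the three outer neighbours
  form a positive triangle (`edge_of_negative_triangle`, `colorable_of_triangle`).
* A positive cycle of length four can be coloured if the centres at two opposite vertices are at
  distance at most three. This is achieved by an additional edge between their outer neighbours, or,
  if these are already joined by an edge of the wrong sign, by recolouring its ends
  (`colorable_of_square`).
* In the remaining case of girth at least five, a vertex `w` and its neighbours are deleted, and for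
  each neighbour of `w` its two other neighbours are joined by an edge. Then each neighbour of `w`
  excludes at most three of the ten colours of `w`, and one colour is left (`colorable_of_girth`).

The additional edges never create a `K₄` with negative triangles: `K₄` without an edge contains a
diamond, and `K₄` without a matching contains a cycle of length four. Finally, in maximum degree
three such a `K₄` is a component that is switching isomorphic to `(K₄, -)` (`isGood_ofSimple`).
-/

namespace SignedGraph

/-! ### Finite facts about the circle of ten colours -/

/-- Two colours are at distance at most `k` on the circle `ZMod 10`. -/
def Within (k : ℕ) (p q : ZMod 10) : Prop := (p - q).val ≤ k ∨ (q - p).val ≤ k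

instance (k : ℕ) (p q : ZMod 10) : Decidable (Within k p q) := instDecidableOr

/-- The rotation of the circle of colours by which a sign acts: `1` acts trivially and `-1` takes
each colour to its antipode. -/
def off (s : ℤˣ) : ZMod 10 := if s = 1 then 0 else 5

theorem Within.symm {k : ℕ} {p q : ZMod 10} (h : Within k p q) : Within k q p := Or.symm h

theorem Within.of_sub_eq {k : ℕ} {p q p' q' : ZMod 10} (h : Within k p q)
    (e : p - q = p' - q') : Within k p' q' := by
  have e' : q - p = q' - p' := by linear_combination -e
  unfold Within at *
  rwa [← e, ← e']

theorem Within.mono {k l : ℕ} (hkl : k ≤ l) {p q : ZMod 10} (h : Within k p q) : Within l p q :=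
  h.imp (fun h => h.trans hkl) (fun h => h.trans hkl)

theorem within_self (k : ℕ) (p : ZMod 10) : Within k p p := by simp [Within]

theorem off_add_self (s : ℤˣ) : off s + off s = 0 := by
  revert s; decide

theorem off_mul (s t : ℤˣ) : off (s * t) = off s + off t := by
  revert s t; decide

/-- A rotation by an antipodal map can be moved from one side of `Within` to the other. -/
theorem Within.off_symm {k : ℕ} {p q : ZMod 10} {s : ℤˣ} (h : Within k p (q + off s)) :
    Within k q (p + off s) :=
  h.symm.of_sub_eq (by linear_combination off_add_self s)

theorem off_mul_of_mul_eq {r s t : ℤˣ} (h : r * s * t = 1) : off t = off r + off s := by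
  revert r s t; decide

theorem off_mul_of_mul_eq_neg {r s t : ℤˣ} (h : r * s * t = -1) :
    off t = off r + off s + 5 := by
  revert r s t; decide

/-- A positive triangle `uvw` can be coloured whatever the constraints from outside: three colours
are pairwise at distance at most two iff they lie in a common window of three consecutive colours,
and each outer constraint excludes only three of the ten windows. Here `r`, `s`, `t` are the signs of `uv`, `vw`,
`uw`, and `a`, `b`, `c` are the centres of the outer constraints. -/
theorem exists_positive_triangle (a b c : ZMod 10) {r s t : ℤˣ} (h : r * s * t = 1) :
    ∃ p q l, Within 2 p a ∧ Within 2 q b ∧ Within 2 l c ∧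
      Within 2 p (q + off r) ∧ Within 2 q (l + off s) ∧ Within 2 p (l + off t) := by
  -- A rotation of the circle makes `a = 0`, and switching at `v` and `w` makes the edges positive.
  -- The same normalisation is used in the following lemmas.
  have key : ∀ b c : ZMod 10, ∃ p, Within 2 p 0 ∧ ∃ q, Within 2 q b ∧ Within 2 p q ∧
      ∃ l, Within 2 l c ∧ Within 2 q l ∧ Within 2 p l := by decide +kernel
  obtain ⟨p, hp, q, hq, hpq, l, hl, hql, hpl⟩ := key (b + off r - a) (c + off t - a)
  have et := off_mul_of_mul_eq h
  have er := off_add_self r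
  have es := off_add_self s
  refine ⟨p + a, q + a + off r, l + a + off t, hp.of_sub_eq ?_, hq.of_sub_eq ?_, hl.of_sub_eq ?_,
    hpq.of_sub_eq ?_, hql.of_sub_eq ?_, hpl.of_sub_eq ?_⟩
  · ring
  · linear_combination -er
  · linear_combination (-2) * et - er - es
  · linear_combination er
  · linear_combination et + es
  · linear_combination 2 * et + er + es

/-- A negative triangle can be coloured if the centres of the outer constraints at two of its
vertices satisfy themselves the condition on the colours of these vertices. -/
theorem exists_negative_triangle (a b c : ZMod 10) {r s t : ℤˣ} (h : r * s * t = -1)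
    (hab : Within 2 a (b + off r)) :
    ∃ p q l, Within 2 p a ∧ Within 2 q b ∧ Within 2 l c ∧
      Within 2 p (q + off r) ∧ Within 2 q (l + off s) ∧ Within 2 p (l + off t) := by
  have key : ∀ b c : ZMod 10, Within 2 0 b → ∃ p, Within 2 p 0 ∧ ∃ q, Within 2 q b ∧
      Within 2 p q ∧ ∃ l, Within 2 l c ∧ Within 2 q (l + 5) ∧ Within 2 p l := by decide +kernel
  have et := off_mul_of_mul_eq_neg h
  have er := off_add_self r
  have es := off_add_self s
  have e5 : (10 : ZMod 10) = 0 := rfl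
  obtain ⟨p, hp, q, hq, hpq, l, hl, hql, hpl⟩ := key (b + off r - a) (c + off t - a)
    (hab.of_sub_eq (by ring))
  refine ⟨p + a, q + a + off r, l + a + off t, hp.of_sub_eq ?_, hq.of_sub_eq ?_, hl.of_sub_eq ?_,
    hpq.of_sub_eq ?_, hql.of_sub_eq ?_, hpl.of_sub_eq ?_⟩
  · ring
  · linear_combination -er
  · linear_combination (-2) * et - er - es - e5
  · linear_combination er
  · linear_combination et + es
  · linear_combination 2 * et + er + es + e5

/-- Two negative triangles `uvw` and `uvx` with the common edge `uv` can be coloured whatever the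
constraints on `w` and `x` from outside. Here `r`, `s`, `t`, `s'`, `t'` are the signs of `uv`, `vw`,
`uw`, `vx`, `ux`. -/
theorem exists_negative_diamond (a b : ZMod 10) {r s t s' t' : ℤˣ} (h : r * s * t = -1)
    (h' : r * s' * t' = -1) :
    ∃ p q l m, Within 2 l a ∧ Within 2 m b ∧ Within 2 p (q + off r) ∧
      Within 2 q (l + off s) ∧ Within 2 p (l + off t) ∧
      Within 2 q (m + off s') ∧ Within 2 p (m + off t') := by
  have key : ∀ b : ZMod 10, ∃ l, Within 2 l 0 ∧ ∃ m, Within 2 m b ∧ ∃ p, Within 2 p l ∧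
      Within 2 p m ∧ ∃ q, Within 2 p q ∧ Within 2 q (l + 5) ∧ Within 2 q (m + 5) := by
    decide +kernel
  have et := off_mul_of_mul_eq_neg h
  have et' := off_mul_of_mul_eq_neg h'
  have er := off_add_self r
  have es := off_add_self s
  have es' := off_add_self s'
  have e5 : (10 : ZMod 10) = 0 := rfl
  obtain ⟨l, hl, m, hm, p, hpl, hpm, q, hpq, hql, hqm⟩ := key (b + off t' - a - off t)
  refine ⟨p + a + off t, q + a + off t + off r, l + a, m + a + off t + off t', hl.of_sub_eq ?_,
    hm.of_sub_eq ?_, hpq.of_sub_eq ?_, hql.of_sub_eq ?_, hpl.of_sub_eq ?_, hqm.of_sub_eq ?_,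
    hpm.of_sub_eq ?_⟩
  · ring
  · linear_combination (-2) * et' - er - es' - e5
  · linear_combination er
  · linear_combination (-1) * et - er - e5
  · ring
  · linear_combination et' + es'
  · linear_combination 2 * et' + er + es' + e5

/-- A negative cycle of length four can be coloured whatever the constraints from outside. -/
theorem exists_negative_square (a b c d : ZMod 10) {r s t u : ℤˣ} (h : r * s * t * u = -1) :
    ∃ p q l m, Within 2 p a ∧ Within 2 q b ∧ Within 2 l c ∧ Within 2 m d ∧
      Within 2 p (q + off r) ∧ Within 2 q (l + off s) ∧ Within 2 l (m + off t) ∧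
      Within 2 m (p + off u) := by
  have key : ∀ b c d : ZMod 10, ∃ p, Within 2 p 0 ∧ ∃ q, Within 2 q b ∧ Within 2 p q ∧
      ∃ l, Within 2 l c ∧ Within 2 q l ∧ ∃ m, Within 2 m d ∧ Within 2 l m ∧
      Within 2 m (p + 5) := by
    set_option synthInstance.maxHeartbeats 400000 in
    set_option synthInstance.maxSize 1000 in
    decide +kernel
  have eu : off u = off r + off s + off t + 5 := by
    revert h; revert r s t u; decide
  have er := off_add_self r
  have es := off_add_self s
  have et := off_add_self t
  obtain ⟨p, hp, q, hq, hpq, l, hl, hql, m, hm, hlm, hmp⟩ :=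
    key (b + off r - a) (c + off r + off s - a) (d + off r + off s + off t - a)
  refine ⟨p + a, q + a + off r, l + a + off r + off s, m + a + off r + off s + off t,
    hp.of_sub_eq ?_, hq.of_sub_eq ?_, hl.of_sub_eq ?_, hm.of_sub_eq ?_, hpq.of_sub_eq ?_,
    hql.of_sub_eq ?_, hlm.of_sub_eq ?_, hmp.of_sub_eq ?_⟩
  · ring
  · linear_combination -er
  · linear_combination -er - es
  · linear_combination -er - es - et
  · linear_combination er
  · linear_combination es
  · linear_combination et
  · linear_combination eu

/-- A positive cycle of length four can be coloured if the outer constraints at two opposite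
vertices have centres at distance at most three. -/
theorem exists_positive_square (a b c d : ZMod 10) {r s t u : ℤˣ} (h : r * s * t * u = 1)
    (hac : Within 3 a (c + off r + off s)) :
    ∃ p q l m, Within 2 p a ∧ Within 2 q b ∧ Within 2 l c ∧ Within 2 m d ∧
      Within 2 p (q + off r) ∧ Within 2 q (l + off s) ∧ Within 2 l (m + off t) ∧
      Within 2 m (p + off u) := by
  have key : ∀ b c d : ZMod 10, Within 3 0 c → ∃ p, Within 2 p 0 ∧ ∃ q, Within 2 q b ∧
      Within 2 p q ∧ ∃ l, Within 2 l c ∧ Within 2 q l ∧ ∃ m, Within 2 m d ∧ Within 2 l m ∧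
      Within 2 m p := by
    set_option synthInstance.maxHeartbeats 400000 in
    set_option synthInstance.maxSize 1000 in
    decide +kernel
  have eu : off u = off r + off s + off t := by
    revert h; clear hac; revert r s t u; decide
  have er := off_add_self r
  have es := off_add_self s
  have et := off_add_self t
  obtain ⟨p, hp, q, hq, hpq, l, hl, hql, m, hm, hlm, hmp⟩ :=
    key (b + off r - a) (c + off r + off s - a) (d + off r + off s + off t - a)
      (hac.of_sub_eq (by ring))
  refine ⟨p + a, q + a + off r, l + a + off r + off s, m + a + off r + off s + off t,
    hp.of_sub_eq ?_, hq.of_sub_eq ?_, hl.of_sub_eq ?_, hm.of_sub_eq ?_, hpq.of_sub_eq ?_,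
    hql.of_sub_eq ?_, hlm.of_sub_eq ?_, hmp.of_sub_eq ?_⟩
  · ring
  · linear_combination -er
  · linear_combination -er - es
  · linear_combination -er - es - et
  · linear_combination er
  · linear_combination es
  · linear_combination et
  · linear_combination eu

/-- Whatever the constraints from outside, the ends of an edge can be coloured in such a way that
their colours violate the condition for an edge of the opposite sign by no more than one. -/
theorem exists_edge_within_three (a b : ZMod 10) (s : ℤˣ) :
    ∃ p q, Within 2 p a ∧ Within 2 q b ∧ Within 2 p (q + off s) ∧
      Within 3 p (q + off (-s)) := by
  have key : ∀ (s : ℤˣ) (a b : ZMod 10), ∃ p, Within 2 p a ∧ ∃ q, Within 2 q b ∧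
      Within 2 p (q + off s) ∧ Within 3 p (q + off (-s)) := by decide +kernel
  obtain ⟨p, hp, q, hq, h, h'⟩ := key s a b
  exact ⟨p, q, hp, hq, h, h'⟩

/-- If a vertex has two outer constraints whose centres are within distance two, then all colours
but three of a further neighbour are allowed. -/
theorem exists_center_of_within_two {a b : ZMod 10} (h : Within 2 a b) :
    ∃ m, ∀ p, Within 3 p m → ∃ q, Within 2 p q ∧ Within 2 q a ∧ Within 2 q b := by
  have key : ∀ b : ZMod 10, Within 2 0 b → ∃ m, ∀ p, Within 3 p m →
      ∃ q, Within 2 p q ∧ Within 2 q 0 ∧ Within 2 q b := by decide +kernel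
  obtain ⟨m, hm⟩ := key (b - a) (h.of_sub_eq (by ring))
  refine ⟨m + a, fun p hp => ?_⟩
  obtain ⟨q, h₁, h₂, h₃⟩ := hm (p - a) (hp.of_sub_eq (by ring))
  exact ⟨q + a, h₁.of_sub_eq (by ring), h₂.of_sub_eq (by ring), h₃.of_sub_eq (by ring)⟩

/-- Three constraints, each of which excludes three of the ten colours, leave a colour. -/
theorem exists_within_three (a b c : ZMod 10) :
    ∃ p, Within 3 p a ∧ Within 3 p b ∧ Within 3 p c := by
  have key : ∀ a b c : ZMod 10, ∃ p, Within 3 p a ∧ Within 3 p b ∧ Within 3 p c := by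
    decide +kernel
  exact key a b c

/-! ### Signed subcubic graphs, deletion and rewiring -/

variable {V : Type*} {Γ : SignedGraph V}

/-- Adjacency, regardless of signs. -/
def Adj (Γ : SignedGraph V) (u v : V) : Prop := ∃ s, Γ.edge s u v

theorem Adj.symm {u v : V} (h : Γ.Adj u v) : Γ.Adj v u :=
  h.imp fun s hs => Γ.symm s u v hs

/-- The vertices of positive degree. -/
def support (Γ : SignedGraph V) : Set V := {v | ∃ u, Γ.Adj v u}

/-- `u`, `v`, `w` are the vertices of a triangle and `ε` is the product of the signs of its
edges. -/
def Triangle (Γ : SignedGraph V) (ε : ℤˣ) (u v w : V) : Prop :=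
  ∃ r s t, Γ.edge r u v ∧ Γ.edge s v w ∧ Γ.edge t u w ∧ r * s * t = ε

theorem Triangle.rotate {ε : ℤˣ} {u v w : V} (h : Γ.Triangle ε u v w) : Γ.Triangle ε v w u := by
  obtain ⟨r, s, t, hr, hs, ht, e⟩ := h
  exact ⟨s, t, r, hs, Γ.symm _ _ _ ht, Γ.symm _ _ _ hr, by rw [← e]; ac_rfl⟩

theorem exists_triangle {u v w : V} (huv : Γ.Adj u v) (hvw : Γ.Adj v w) (huw : Γ.Adj u w) :
    Γ.Triangle 1 u v w ∨ Γ.Triangle (-1) u v w := by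
  obtain ⟨r, hr⟩ := huv
  obtain ⟨s, hs⟩ := hvw
  obtain ⟨t, ht⟩ := huw
  exact (Int.units_eq_one_or (r * s * t)).imp (fun e => ⟨r, s, t, hr, hs, ht, e⟩)
    (fun e => ⟨r, s, t, hr, hs, ht, e⟩)

/-- All four triangles on `a`, `b`, `c`, `d` are negative, that is, these vertices induce a signed
graph that can be switched to `(K₄, -)`. -/
def NegK4 (Γ : SignedGraph V) (a b c d : V) : Prop :=
  Γ.Triangle (-1) a b c ∧ Γ.Triangle (-1) a b d ∧ Γ.Triangle (-1) a c d ∧ Γ.Triangle (-1) b c d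

/-- A signed simple graph of maximum degree at most three that contains no `(K₄, -)` up to
switching. The degree bound says that three vertices cover the neighbours of each vertex. -/
structure IsGood (Γ : SignedGraph V) : Prop where
  loopless : ∀ s v, ¬ Γ.edge s v v
  simple : ∀ s t u v, Γ.edge s u v → Γ.edge t u v → s = t
  subcubic : ∀ v, ∃ x y z, ∀ b, Γ.Adj v b → b = x ∨ b = y ∨ b = z
  not_negK4 : ∀ a b c d, ¬ Γ.NegK4 a b c d

/-- A circular `10/3`-colouring, with the colours placed on the circle `ZMod 10`. -/
def IsColoring (Γ : SignedGraph V) (f : V → ZMod 10) : Prop :=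
  ∀ s u v, Γ.edge s u v → Within 2 (f u) (f v + off s)

/-- `f` is a colouring of the signed graph without the vertices in `H`. -/
def IsColoringOff (Γ : SignedGraph V) (H : Set V) (f : V → ZMod 10) : Prop :=
  ∀ s u v, u ∉ H → v ∉ H → Γ.edge s u v → Within 2 (f u) (f v + off s)

/-- All edges at the vertices in `H` are deleted. The vertices stay as isolated vertices. -/
def deleteVerts (Γ : SignedGraph V) (H : Set V) : SignedGraph V where
  edge s u v := u ∉ H ∧ v ∉ H ∧ Γ.edge s u v
  symm _ _ _ h := ⟨h.2.1, h.1, Γ.symm _ _ _ h.2.2⟩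

/-- All edges at the vertices in `H` are deleted, and an edge of sign `ε` between `x` and `y` is
added. -/
def rewire (Γ : SignedGraph V) (H : Set V) (ε : ℤˣ) (x y : V) : SignedGraph V where
  edge s u v := (u ∉ H ∧ v ∉ H ∧ Γ.edge s u v) ∨ (s = ε ∧ (u = x ∧ v = y ∨ u = y ∧ v = x))
  symm := by
    rintro s u v (⟨h₁, h₂, h₃⟩ | ⟨h₁, h₂⟩)
    · exact Or.inl ⟨h₂, h₁, Γ.symm _ _ _ h₃⟩
    · exact Or.inr ⟨h₁, h₂.symm.imp And.symm And.symm⟩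

namespace IsGood

theorem ne (hΓ : Γ.IsGood) {u v : V} (h : Γ.Adj u v) : u ≠ v := by
  rintro rfl
  obtain ⟨s, hs⟩ := h
  exact hΓ.loopless s u hs

theorem deleteVerts (hΓ : Γ.IsGood) (H : Set V) : (Γ.deleteVerts H).IsGood where
  loopless s v h := hΓ.loopless s v h.2.2
  simple s t u v h h' := hΓ.simple s t u v h.2.2 h'.2.2
  subcubic v := by
    obtain ⟨x, y, z, h⟩ := hΓ.subcubic v
    exact ⟨x, y, z, fun b ⟨s, hs⟩ => h b ⟨s, hs.2.2⟩⟩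
  not_negK4 a b c d h := by
    have aux : ∀ u v w, (Γ.deleteVerts H).Triangle (-1) u v w → Γ.Triangle (-1) u v w :=
      fun u v w ⟨r, s, t, hr, hs, ht, e⟩ => ⟨r, s, t, hr.2.2, hs.2.2, ht.2.2, e⟩
    exact hΓ.not_negK4 a b c d
      ⟨aux _ _ _ h.1, aux _ _ _ h.2.1, aux _ _ _ h.2.2.1, aux _ _ _ h.2.2.2⟩

/-- Replacing a piece that is attached to `x` and to `y` by an edge between `x` and `y` creates no
`(K₄, -)` in the absence of diamonds, since `K₄` without an edge is a diamond. -/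
theorem rewire (hΓ : Γ.IsGood) {H : Set V} (ε : ℤˣ) {x y h k : V} (hx : x ∉ H) (hy : y ∉ H)
    (hxy : x ≠ y) (hadj : ¬ Γ.Adj x y) (hh : h ∈ H) (hxh : Γ.Adj x h) (hk : k ∈ H)
    (hyk : Γ.Adj y k)
    (hd : ∀ p q, Γ.Adj p q → Γ.Adj x p → Γ.Adj x q → Γ.Adj y p → Γ.Adj y q → False) :
    (Γ.rewire H ε x y).IsGood where
  loopless := by
    rintro s v (h | ⟨-, ⟨rfl, h⟩ | ⟨rfl, h⟩⟩)
    · exact hΓ.loopless s v h.2.2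
    · exact hxy h
    · exact hxy h.symm
  simple := by
    rintro s t u v (h | ⟨rfl, h⟩) (h' | ⟨rfl, h'⟩)
    · exact hΓ.simple s t u v h.2.2 h'.2.2
    · rcases h' with ⟨rfl, rfl⟩ | ⟨rfl, rfl⟩
      · exact absurd ⟨s, h.2.2⟩ hadj
      · exact absurd (Adj.symm ⟨s, h.2.2⟩) hadj
    · rcases h with ⟨rfl, rfl⟩ | ⟨rfl, rfl⟩
      · exact absurd ⟨t, h'.2.2⟩ hadj
      · exact absurd (Adj.symm ⟨t, h'.2.2⟩) hadj
    · rfl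
  subcubic v := by
    classical
    obtain ⟨a, b, c, hv⟩ := hΓ.subcubic v
    -- The new neighbour takes the place of a deleted one.
    have hslot : ∃ φ : V → V, ∀ d, (Γ.rewire H ε x y).Adj v d → ∃ e, Γ.Adj v e ∧ d = φ e := by
      by_cases hvx : v = x
      · refine ⟨fun e => if e ∈ H then y else e, ?_⟩
        rintro d ⟨s, hs | ⟨-, ⟨-, rfl⟩ | ⟨h', -⟩⟩⟩
        · exact ⟨d, ⟨s, hs.2.2⟩, by simp [hs.2.1]⟩
        · exact ⟨h, hvx ▸ hxh, by simp [hh]⟩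
        · exact absurd (hvx.symm.trans h') hxy
      · refine ⟨fun e => if e ∈ H then x else e, ?_⟩
        rintro d ⟨s, hs | ⟨-, ⟨h', -⟩ | ⟨h', rfl⟩⟩⟩
        · exact ⟨d, ⟨s, hs.2.2⟩, by simp [hs.2.1]⟩
        · exact absurd h' hvx
        · exact ⟨k, h' ▸ hyk, by simp [hk]⟩
    obtain ⟨φ, hφ⟩ := hslot
    refine ⟨φ a, φ b, φ c, fun d hd => ?_⟩
    obtain ⟨e, he, rfl⟩ := hφ d hd
    rcases hv e he with rfl | rfl | rfl <;> simp
  not_negK4 := by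
    have adj_cases : ∀ {u v}, (Γ.rewire H ε x y).Adj u v →
        Γ.Adj u v ∨ (u = x ∧ v = y ∨ u = y ∧ v = x) := by
      rintro u v ⟨s, h | h⟩
      · exact Or.inl ⟨s, h.2.2⟩
      · exact Or.inr h.2
    have old : ∀ {ε' u v w}, (Γ.rewire H ε x y).Triangle ε' u v w → Γ.Adj u v → Γ.Adj v w →
        Γ.Adj u w → Γ.Triangle ε' u v w := by
      have aux : ∀ {s u v}, (Γ.rewire H ε x y).edge s u v → Γ.Adj u v → Γ.edge s u v := by
        rintro s u v (h | ⟨-, ⟨rfl, rfl⟩ | ⟨rfl, rfl⟩⟩) h'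
        · exact h.2.2
        · exact absurd h' hadj
        · exact absurd h'.symm hadj
      rintro ε' u v w ⟨r, s, t, hr, hs, ht, e⟩ h₁ h₂ h₃
      exact ⟨r, s, t, aux hr h₁, aux hs h₂, aux ht h₃, e⟩
    rintro a b c d ⟨h₁, h₂, h₃, h₄⟩
    have tadj : ∀ {u v w}, (Γ.rewire H ε x y).Triangle (-1) u v w →
        (Γ.rewire H ε x y).Adj u v ∧ (Γ.rewire H ε x y).Adj v w ∧ (Γ.rewire H ε x y).Adj u w :=
      fun ⟨r, s, t, hr, hs, ht, _⟩ => ⟨⟨r, hr⟩, ⟨s, hs⟩, ⟨t, ht⟩⟩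
    have ndiag : ∀ {v}, ¬ Γ.Adj v v := fun h => hΓ.ne h rfl
    obtain ⟨nab, nbc, nac⟩ := tadj h₁
    obtain ⟨-, nbd, nad⟩ := tadj h₂
    obtain ⟨-, ncd, -⟩ := tadj h₃
    have dd : ∀ p q u v, (u = x ∧ v = y ∨ u = y ∧ v = x) → Γ.Adj p q → Γ.Adj u p → Γ.Adj u q →
        Γ.Adj v p → Γ.Adj v q → False := by
      rintro p q u v (⟨rfl, rfl⟩ | ⟨rfl, rfl⟩) e₁ e₂ e₃ e₄ e₅
      · exact hd p q e₁ e₂ e₃ e₄ e₅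
      · exact hd p q e₁ e₄ e₅ e₂ e₃
    have ndist : ∀ {u v}, (Γ.rewire H ε x y).Adj u v → u ≠ v := by
      intro u v h
      rcases adj_cases h with h | ⟨rfl, rfl⟩ | ⟨rfl, rfl⟩
      exacts [hΓ.ne h, hxy, hxy.symm]
    have dab := ndist nab
    have dbc := ndist nbc
    have dac := ndist nac
    have dbd := ndist nbd
    have dad := ndist nad
    have dcd := ndist ncd
    have oab := adj_cases nab
    have obc := adj_cases nbc
    have oac := adj_cases nac
    have obd := adj_cases nbd
    have oad := adj_cases nad
    have ocd := adj_cases ncd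
    rcases oab with oab | n
    · rcases oac with oac | n
      · rcases oad with oad | n
        · rcases obc with obc | n
          · rcases obd with obd | n
            · rcases ocd with ocd | n
              · exact hΓ.not_negK4 a b c d ⟨old h₁ oab obc oac, old h₂ oab obd oad,
                  old h₃ oac ocd oad, old h₄ obc ocd obd⟩
              · exact dd a b c d n oab oac.symm obc.symm oad.symm obd.symm
            · have e : Γ.Adj c d := by grind
              exact dd a c b d n oac oab.symm obc oad.symm e.symm
          · have e₁ : Γ.Adj b d := by grind
            have e₂ : Γ.Adj c d := by grind
            exact dd a d b c n oad oab.symm e₁ oac.symm e₂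
        · have e₁ : Γ.Adj b c := by grind
          have e₂ : Γ.Adj b d := by grind
          have e₃ : Γ.Adj c d := by grind
          exact dd b c a d n e₁ oab oac e₂.symm e₃.symm
      · have e₁ : Γ.Adj b c := by grind
        have e₂ : Γ.Adj b d := by grind
        have e₃ : Γ.Adj c d := by grind
        have e₄ : Γ.Adj a d := by grind
        exact dd b d a c n e₂ oab e₄ e₁.symm e₃
    · have e₁ : Γ.Adj b c := by grind
      have e₂ : Γ.Adj b d := by grind
      have e₃ : Γ.Adj c d := by grind
      have e₄ : Γ.Adj a d := by grind
      have e₅ : Γ.Adj a c := by grind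
      exact dd c d a b n e₃ e₅ e₄ e₁ e₂

end IsGood

/-! ### Recolouring a deleted piece -/

theorem isColoring_of_off {H : Set V} {f g : V → ZMod 10} (hf : Γ.IsColoringOff H f)
    (hg : ∀ v, v ∉ H → g v = f v)
    (hH : ∀ v ∈ H, ∀ s b, Γ.edge s v b → Within 2 (g v) (g b + off s)) : Γ.IsColoring g := by
  intro s u v h
  by_cases hu : u ∈ H
  · exact hH u hu s v h
  by_cases hv : v ∈ H
  · exact (hH v hv s u (Γ.symm _ _ _ h)).off_symm
  rw [hg u hu, hg v hv]
  exact hf s u v hu hv h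

theorem exists_recolor_three (f : V → ZMod 10) {u v w : V} (huv : u ≠ v) (huw : u ≠ w)
    (hvw : v ≠ w) (p q l : ZMod 10) :
    ∃ g : V → ZMod 10, g u = p ∧ g v = q ∧ g w = l ∧
      ∀ x, x ∉ ({u, v, w} : Set V) → g x = f x := by
  classical
  refine ⟨Function.update (Function.update (Function.update f w l) v q) u p, ?_, ?_, ?_, ?_⟩
  · simp
  · simp [huv.symm]
  · simp [huw.symm, hvw.symm]
  · intro x hx
    simp only [Set.mem_insert_iff, Set.mem_singleton_iff, not_or] at hx
    simp [hx.1, hx.2.1, hx.2.2]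

theorem exists_recolor_four (f : V → ZMod 10) {u v w z : V} (huv : u ≠ v) (huw : u ≠ w)
    (hvw : v ≠ w) (huz : u ≠ z) (hvz : v ≠ z) (hwz : w ≠ z) (p q l m : ZMod 10) :
    ∃ g : V → ZMod 10, g u = p ∧ g v = q ∧ g w = l ∧ g z = m ∧
      ∀ x, x ∉ ({u, v, w, z} : Set V) → g x = f x := by
  classical
  obtain ⟨g, h₁, h₂, h₃, h₄⟩ := exists_recolor_three (Function.update f z m) huv huw hvw p q l
  refine ⟨g, h₁, h₂, h₃, ?_, ?_⟩
  · rw [h₄ z (by simp [huz.symm, hvz.symm, hwz.symm])]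
    simp
  · intro x hx
    simp only [Set.mem_insert_iff, Set.mem_singleton_iff, not_or] at hx
    rw [h₄ x (by simp [hx.1, hx.2.1, hx.2.2.1])]
    simp [hx.2.2.2]

/-- The colours within distance two of `a` suit all neighbours of `u` other than `v` and `w`. For a
vertex of degree three, `a` is the colour of the third neighbour or its antipode, according to the
sign. -/
def IsCenter (Γ : SignedGraph V) (f : V → ZMod 10) (u v w : V) (a : ZMod 10) : Prop :=
  ∀ p, Within 2 p a → ∀ b s, Γ.edge s u b → b = v ∨ b = w ∨ Within 2 p (f b + off s)

namespace IsGood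

/-- A vertex with two given neighbours `v` and `w` has at most one further neighbour. -/
theorem third_neighbor (hΓ : Γ.IsGood) {u v w : V} (hv : Γ.Adj u v) (hw : Γ.Adj u w)
    (hvw : v ≠ w) : (∀ b, Γ.Adj u b → b = v ∨ b = w) ∨
      ∃ x s, Γ.edge s u x ∧ x ≠ v ∧ x ≠ w ∧ ∀ b, Γ.Adj u b → b = v ∨ b = w ∨ b = x := by
  by_cases h : ∃ x, Γ.Adj u x ∧ x ≠ v ∧ x ≠ w
  · obtain ⟨x, ⟨s, hs⟩, hxv, hxw⟩ := h
    have hx : Γ.Adj u x := ⟨s, hs⟩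
    refine Or.inr ⟨x, s, hs, hxv, hxw, fun b hb => ?_⟩
    obtain ⟨a, b', c, hc⟩ := hΓ.subcubic u
    have h₁ := hc v hv
    have h₂ := hc w hw
    have h₃ := hc x hx
    have h₄ := hc b hb
    clear hc
    grind
  · left
    intro b hb
    by_contra hcon
    exact h ⟨b, hb, not_or.1 hcon⟩

theorem isCenter (hΓ : Γ.IsGood) (f : V → ZMod 10) {u v w x : V} {s : ℤˣ} (hs : Γ.edge s u x)
    (hx : ∀ b, Γ.Adj u b → b = v ∨ b = w ∨ b = x) : Γ.IsCenter f u v w (f x + off s) := by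
  intro p hp b t ht
  refine (hx b ⟨t, ht⟩).imp_right (Or.imp_right ?_)
  rintro rfl
  rwa [hΓ.simple t s u b ht hs]

theorem exists_isCenter (hΓ : Γ.IsGood) (f : V → ZMod 10) {u v w : V} (hv : Γ.Adj u v)
    (hw : Γ.Adj u w) (hvw : v ≠ w) : ∃ a, Γ.IsCenter f u v w a := by
  rcases hΓ.third_neighbor hv hw hvw with h | ⟨x, s, hs, -, -, hx⟩
  · exact ⟨0, fun p _ b t ht => (h b ⟨t, ht⟩).imp_right Or.inl⟩
  · exact ⟨_, hΓ.isCenter f hs hx⟩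

/-- A colouring condition that holds for one edge between two vertices holds for all of them, in
both directions. -/
theorem within_of_edge (hΓ : Γ.IsGood) {g : V → ZMod 10} {r s : ℤˣ} {u v : V}
    (hr : Γ.edge r u v) (h : Within 2 (g u) (g v + off r)) :
    (Γ.edge s u v → Within 2 (g u) (g v + off s)) ∧
      (Γ.edge s v u → Within 2 (g v) (g u + off s)) := by
  constructor
  · intro hs
    rwa [hΓ.simple s r u v hs hr]
  · intro hs
    rw [hΓ.simple s r u v (Γ.symm _ _ _ hs) hr]
    exact h.off_symm

theorem extend_triangle (hΓ : Γ.IsGood) {f : V → ZMod 10} {u v w : V} {r s t : ℤˣ}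
    (hr : Γ.edge r u v) (hs : Γ.edge s v w) (ht : Γ.edge t u w)
    (hf : Γ.IsColoringOff {u, v, w} f) {a b c p q l : ZMod 10} (ha : Γ.IsCenter f u v w a)
    (hb : Γ.IsCenter f v u w b) (hc : Γ.IsCenter f w u v c) (hp : Within 2 p a)
    (hq : Within 2 q b) (hl : Within 2 l c) (hpq : Within 2 p (q + off r))
    (hql : Within 2 q (l + off s)) (hpl : Within 2 p (l + off t)) : ∃ g, Γ.IsColoring g := by
  obtain ⟨g, rfl, rfl, rfl, hg⟩ := exists_recolor_three f (hΓ.ne ⟨r, hr⟩) (hΓ.ne ⟨t, ht⟩)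
    (hΓ.ne ⟨s, hs⟩) p q l
  refine ⟨g, isColoring_of_off hf hg ?_⟩
  have out : ∀ x, x = u ∨ x = v ∨ x = w ∨ g x = f x := by
    intro x
    by_cases hx : x ∈ ({u, v, w} : Set V)
    · simp only [Set.mem_insert_iff, Set.mem_singleton_iff] at hx
      tauto
    · exact Or.inr (Or.inr (Or.inr (hg x hx)))
  have inn : ∀ y x e, Γ.edge e y x → (y = u ∨ y = v ∨ y = w) → (x = u ∨ x = v ∨ x = w) →
      Within 2 (g y) (g x + off e) := by
    rintro y x e he (rfl | rfl | rfl) (rfl | rfl | rfl)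
    exacts [(hΓ.loopless _ _ he).elim, (hΓ.within_of_edge hr hpq).1 he,
      (hΓ.within_of_edge ht hpl).1 he, (hΓ.within_of_edge hr hpq).2 he,
      (hΓ.loopless _ _ he).elim, (hΓ.within_of_edge hs hql).1 he,
      (hΓ.within_of_edge ht hpl).2 he, (hΓ.within_of_edge hs hql).2 he,
      (hΓ.loopless _ _ he).elim]
  intro y hy e x he
  rcases out x with hx | hx | hx | hx
  · exact inn y x e he hy (Or.inl hx)
  · exact inn y x e he hy (Or.inr (Or.inl hx))
  · exact inn y x e he hy (Or.inr (Or.inr hx))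
  rcases hy with rfl | rfl | rfl
  · rcases ha _ hp x e he with h | h | h
    · exact inn y x e he (by simp) (by simp [h])
    · exact inn y x e he (by simp) (by simp [h])
    · rwa [hx]
  · rcases hb _ hq x e he with h | h | h
    · exact inn y x e he (by simp) (by simp [h])
    · exact inn y x e he (by simp) (by simp [h])
    · rwa [hx]
  · rcases hc _ hl x e he with h | h | h
    · exact inn y x e he (by simp) (by simp [h])
    · exact inn y x e he (by simp) (by simp [h])
    · rwa [hx]

end IsGood

/-- Every good signed graph on fewer vertices of positive degree can be coloured. This is what is
known about a minimal counterexample. -/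
def SmallerColorable (Γ : SignedGraph V) : Prop :=
  ∀ Δ : SignedGraph V, Δ.IsGood → Δ.support ⊂ Γ.support → ∃ f, Δ.IsColoring f

namespace IsGood

theorem exists_coloringOff (hΓ : Γ.IsGood) (hI : Γ.SmallerColorable) {H : Set V} {u v : V}
    (hu : u ∈ H) (huv : Γ.Adj u v) : ∃ f, Γ.IsColoringOff H f := by
  obtain ⟨f, hf⟩ := hI (Γ.deleteVerts H) (hΓ.deleteVerts H) (by
    refine ⟨fun x ⟨y, s, hs⟩ => ⟨y, s, hs.2.2⟩, fun h => ?_⟩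
    obtain ⟨y, s, hs⟩ := h (show u ∈ Γ.support from ⟨v, huv⟩)
    exact hs.1 hu)
  exact ⟨f, fun s x y hx hy h => hf s x y ⟨hx, hy, h⟩⟩

theorem exists_coloringOff_rewire (hΓ : Γ.IsGood) (hI : Γ.SmallerColorable) {H : Set V} (ε : ℤˣ)
    {x y h k : V} (hx : x ∉ H) (hy : y ∉ H) (hxy : x ≠ y) (hadj : ¬ Γ.Adj x y) (hh : h ∈ H)
    (hxh : Γ.Adj x h) (hk : k ∈ H) (hyk : Γ.Adj y k)
    (hd : ∀ p q, Γ.Adj p q → Γ.Adj x p → Γ.Adj x q → Γ.Adj y p → Γ.Adj y q → False) :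
    ∃ f, Γ.IsColoringOff H f ∧ Within 2 (f x) (f y + off ε) := by
  obtain ⟨f, hf⟩ := hI (Γ.rewire H ε x y)
    (hΓ.rewire ε hx hy hxy hadj hh hxh hk hyk hd) (by
    refine ⟨?_, fun h' => ?_⟩
    · rintro z ⟨b, s, hs | ⟨-, ⟨rfl, rfl⟩ | ⟨rfl, rfl⟩⟩⟩
      · exact ⟨b, s, hs.2.2⟩
      · exact ⟨h, hxh⟩
      · exact ⟨k, hyk⟩
    · obtain ⟨b, s, hs | ⟨-, ⟨e, -⟩ | ⟨e, -⟩⟩⟩ := h' (show h ∈ Γ.support from ⟨x, hxh.symm⟩)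
      · exact hs.1 hh
      · exact hx (e ▸ hh)
      · exact hy (e ▸ hh))
  exact ⟨f, fun s a b ha hb h => hf s a b (Or.inl ⟨ha, hb, h⟩),
    hf ε x y (Or.inr ⟨rfl, Or.inl ⟨rfl, rfl⟩⟩)⟩

/-! ### Triangles -/

theorem colorable_of_positive_triangle (hΓ : Γ.IsGood) (hI : Γ.SmallerColorable) {u v w : V}
    (h : Γ.Triangle 1 u v w) : ∃ f, Γ.IsColoring f := by
  obtain ⟨r, s, t, hr, hs, ht, e⟩ := h
  have huv : Γ.Adj u v := ⟨r, hr⟩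
  have hvw : Γ.Adj v w := ⟨s, hs⟩
  have huw : Γ.Adj u w := ⟨t, ht⟩
  obtain ⟨f, hf⟩ := hΓ.exists_coloringOff hI (H := {u, v, w}) (by simp) huv
  obtain ⟨a, ha⟩ := hΓ.exists_isCenter f huv huw (hΓ.ne hvw)
  obtain ⟨b, hb⟩ := hΓ.exists_isCenter f huv.symm hvw (hΓ.ne huw)
  obtain ⟨c, hc⟩ := hΓ.exists_isCenter f huw.symm hvw.symm (hΓ.ne huv)
  obtain ⟨p, q, l, hp, hq, hl, hpq, hql, hpl⟩ := exists_positive_triangle a b c e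
  exact hΓ.extend_triangle hr hs ht hf ha hb hc hp hq hl hpq hql hpl

/-- Two triangles `uvw` and `uvx` with a common edge do not occur in a minimal counterexample. If
`w` and `x` are adjacent, then one of the triangles on the four vertices is positive. -/
theorem colorable_of_diamond (hΓ : Γ.IsGood) (hI : Γ.SmallerColorable) {u v w x : V}
    (huv : Γ.Adj u v) (huw : Γ.Adj u w) (hvw : Γ.Adj v w) (hux : Γ.Adj u x) (hvx : Γ.Adj v x)
    (hwx : w ≠ x) : ∃ f, Γ.IsColoring f := by
  by_contra hcon
  have neg : ∀ {a b c}, Γ.Adj a b → Γ.Adj b c → Γ.Adj a c → Γ.Triangle (-1) a b c :=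
    fun h₁ h₂ h₃ => (exists_triangle h₁ h₂ h₃).resolve_left
      fun h => hcon (hΓ.colorable_of_positive_triangle hI h)
  have hwx' : ¬ Γ.Adj w x := fun h => hΓ.not_negK4 u v w x
    ⟨neg huv hvw huw, neg huv hvx hux, neg huw h hux, neg hvw h hvx⟩
  apply hcon
  obtain ⟨r, s, t, hr, hs, ht, e⟩ := neg huv hvw huw
  obtain ⟨r', s', t', hr', hs', ht', e'⟩ := neg huv hvx hux
  obtain rfl := hΓ.simple _ _ _ _ hr hr'
  obtain ⟨f, hf⟩ := hΓ.exists_coloringOff hI (H := {u, v, w, x}) (by simp) huv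
  obtain ⟨a, ha⟩ := hΓ.exists_isCenter f huw.symm hvw.symm (hΓ.ne huv)
  obtain ⟨b, hb⟩ := hΓ.exists_isCenter f hux.symm hvx.symm (hΓ.ne huv)
  obtain ⟨p, q, l, m, hl, hm, hpq, hql, hpl, hqm, hpm⟩ := exists_negative_diamond a b e e'
  obtain ⟨g, rfl, rfl, rfl, rfl, hg⟩ := exists_recolor_four f (hΓ.ne huv) (hΓ.ne huw) (hΓ.ne hvw)
    (hΓ.ne hux) (hΓ.ne hvx) hwx p q l m
  refine ⟨g, isColoring_of_off hf hg ?_⟩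
  -- All neighbours of `u` and of `v` lie in the diamond.
  have full : ∀ {a b c d z}, Γ.Adj a b → Γ.Adj a c → Γ.Adj a d → b ≠ c → b ≠ d → c ≠ d →
      Γ.Adj a z → z = b ∨ z = c ∨ z = d := by
    intro a b c d z h₁ h₂ h₃ n₁ n₂ n₃ hz
    rcases hΓ.third_neighbor h₁ h₂ n₁ with h | ⟨y, -, -, -, -, h⟩
    · exact (h z hz).imp_right Or.inl
    · rcases h d h₃ with rfl | rfl | rfl
      exacts [absurd rfl n₂, absurd rfl n₃, h z hz]
  have out : ∀ {z}, Γ.Adj z w ∨ Γ.Adj z x → z ≠ u → z ≠ v → g z = f z := by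
    intro z hz hzu hzv
    refine hg z ?_
    simp only [Set.mem_insert_iff, Set.mem_singleton_iff, not_or]
    refine ⟨hzu, hzv, ?_, ?_⟩
    · rintro rfl
      exact hz.elim (fun h => hΓ.ne h rfl) hwx'
    · rintro rfl
      exact hz.elim (fun h => hwx' h.symm) (fun h => hΓ.ne h rfl)
  rintro y (rfl | rfl | rfl | rfl) e z he
  · rcases full huv huw hux (hΓ.ne hvw) (hΓ.ne hvx) hwx ⟨e, he⟩ with rfl | rfl | rfl
    exacts [(hΓ.within_of_edge hr hpq).1 he, (hΓ.within_of_edge ht hpl).1 he,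
      (hΓ.within_of_edge ht' hpm).1 he]
  · rcases full huv.symm hvw hvx (hΓ.ne huw) (hΓ.ne hux) hwx ⟨e, he⟩ with rfl | rfl | rfl
    exacts [(hΓ.within_of_edge hr hpq).2 he, (hΓ.within_of_edge hs hql).1 he,
      (hΓ.within_of_edge hs' hqm).1 he]
  · by_cases hzu : z = u
    · subst hzu
      exact (hΓ.within_of_edge ht hpl).2 he
    by_cases hzv : z = v
    · subst hzv
      exact (hΓ.within_of_edge hs hql).2 he
    rw [out (Or.inl ⟨e, Γ.symm _ _ _ he⟩) hzu hzv]
    exact ((ha _ hl z e he).resolve_left hzu).resolve_left hzv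
  · by_cases hzu : z = u
    · subst hzu
      exact (hΓ.within_of_edge ht' hpm).2 he
    by_cases hzv : z = v
    · subst hzv
      exact (hΓ.within_of_edge hs' hqm).2 he
    rw [out (Or.inr ⟨e, Γ.symm _ _ _ he⟩) hzu hzv]
    exact ((hb _ hm z e he).resolve_left hzu).resolve_left hzv

/-- If the vertex `u` of a negative triangle has no outer neighbour, its centre can be chosen to
suit the one at `v`. -/
theorem colorable_of_third_missing (hΓ : Γ.IsGood) (hI : Γ.SmallerColorable) {u v w : V}
    (h : Γ.Triangle (-1) u v w) (hu : ∀ b, Γ.Adj u b → b = v ∨ b = w) :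
    ∃ f, Γ.IsColoring f := by
  obtain ⟨r, s, t, hr, hs, ht, e⟩ := h
  have huv : Γ.Adj u v := ⟨r, hr⟩
  have hvw : Γ.Adj v w := ⟨s, hs⟩
  have huw : Γ.Adj u w := ⟨t, ht⟩
  obtain ⟨f, hf⟩ := hΓ.exists_coloringOff hI (H := {u, v, w}) (by simp) huv
  obtain ⟨b, hb⟩ := hΓ.exists_isCenter f huv.symm hvw (hΓ.ne huw)
  obtain ⟨c, hc⟩ := hΓ.exists_isCenter f huw.symm hvw.symm (hΓ.ne huv)
  obtain ⟨p, q, l, hp, hq, hl, hpq, hql, hpl⟩ :=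
    exists_negative_triangle (b + off r) b c e (within_self 2 _)
  exact hΓ.extend_triangle hr hs ht hf (fun _ _ z k hz => (hu z ⟨k, hz⟩).imp_right Or.inl)
    hb hc hp hq hl hpq hql hpl

/-- In a minimal counterexample without diamonds, the outer neighbours `x` and `y` of two vertices
of a negative triangle are joined by an edge whose sign makes the cycle of length four through
`x`, `u`, `v`, `y` negative: otherwise the centres at `u` and `v` can be brought far enough apart,
if necessary by an additional edge between `x` and `y`. -/
theorem edge_of_negative_triangle (hΓ : Γ.IsGood) (hI : Γ.SmallerColorable)
    (hcon : ¬ ∃ f, Γ.IsColoring f) {u v w x y : V} {r s t α β : ℤˣ} (hr : Γ.edge r u v)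
    (hs : Γ.edge s v w) (ht : Γ.edge t u w) (e : r * s * t = -1) (hx : Γ.edge α u x)
    (hxv : x ≠ v) (hxw : x ≠ w) (hx' : ∀ b, Γ.Adj u b → b = v ∨ b = w ∨ b = x)
    (hy : Γ.edge β v y) (hyu : y ≠ u) (hyw : y ≠ w)
    (hy' : ∀ b, Γ.Adj v b → b = u ∨ b = w ∨ b = y) : Γ.edge (-(α * r * β)) x y := by
  have huv : Γ.Adj u v := ⟨r, hr⟩
  have hvw : Γ.Adj v w := ⟨s, hs⟩
  have huw : Γ.Adj u w := ⟨t, ht⟩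
  have hux : Γ.Adj u x := ⟨α, hx⟩
  have hvy : Γ.Adj v y := ⟨β, hy⟩
  have diamond : ∀ {a b c d}, Γ.Adj a b → Γ.Adj a c → Γ.Adj b c → Γ.Adj a d → Γ.Adj b d →
      c ≠ d → False := fun h₁ h₂ h₃ h₄ h₅ n => hcon (hΓ.colorable_of_diamond hI h₁ h₂ h₃ h₄ h₅ n)
  have hxy : x ≠ y := fun h => diamond huv huw hvw hux (h ▸ hvy) hxw.symm
  -- An edge of sign `α * r * β` between `x` and `y` would imply the condition on the centres.
  have done : ∀ f, Γ.IsColoringOff {u, v, w} f → ¬ Within 2 (f x) (f y + off (α * r * β)) := by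
    intro f hf hxy
    obtain ⟨c, hc⟩ := hΓ.exists_isCenter f huw.symm hvw.symm (hΓ.ne huv)
    have hab : Within 2 (f x + off α) (f y + off β + off r) := by
      refine hxy.of_sub_eq ?_
      rw [off_mul, off_mul]
      linear_combination -off_add_self α
    obtain ⟨p, q, l, hp, hq, hl, hpq, hql, hpl⟩ := exists_negative_triangle _ _ c e hab
    exact hcon (hΓ.extend_triangle hr hs ht hf (hΓ.isCenter f hx hx') (hΓ.isCenter f hy hy') hc
      hp hq hl hpq hql hpl)
  have hxH : x ∉ ({u, v, w} : Set V) := by simp [(hΓ.ne hux).symm, hxv, hxw]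
  have hyH : y ∉ ({u, v, w} : Set V) := by simp [(hΓ.ne hvy).symm, hyu, hyw]
  by_cases hadj : Γ.Adj x y
  · obtain ⟨k, hk⟩ := hadj
    by_cases hk' : k = α * r * β
    · obtain ⟨f, hf⟩ := hΓ.exists_coloringOff hI (H := {u, v, w}) (by simp) huv
      exact absurd (hk' ▸ hf k x y hxH hyH hk) (done f hf)
    · rwa [← Int.units_ne_iff_eq_neg.1 hk']
  · obtain ⟨f, hf, h⟩ := hΓ.exists_coloringOff_rewire hI (α * r * β) hxH hyH hxy hadj
      (h := u) (by simp) hux.symm (k := v) (by simp) hvy.symm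
      (fun p q hpq h₁ h₂ h₃ h₄ => diamond hpq h₁.symm h₂.symm h₃.symm h₄.symm hxy)
    exact absurd h (done f hf)

theorem colorable_of_triangle (hΓ : Γ.IsGood) (hI : Γ.SmallerColorable) {u v w : V}
    (huv : Γ.Adj u v) (hvw : Γ.Adj v w) (huw : Γ.Adj u w) : ∃ f, Γ.IsColoring f := by
  by_contra hcon
  have h : Γ.Triangle (-1) u v w := (exists_triangle huv hvw huw).resolve_left
    fun h => hcon (hΓ.colorable_of_positive_triangle hI h)
  rcases hΓ.third_neighbor huv huw (hΓ.ne hvw) with hu | ⟨x, α, hx, hxv, hxw, hx'⟩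
  · exact hcon (hΓ.colorable_of_third_missing hI h hu)
  rcases hΓ.third_neighbor hvw huv.symm (hΓ.ne huw).symm with hv | ⟨y, β, hy, hyw, hyu, hy'⟩
  · exact hcon (hΓ.colorable_of_third_missing hI h.rotate hv)
  rcases hΓ.third_neighbor huw.symm hvw.symm (hΓ.ne huv) with hw | ⟨z, γ, hz, hzu, hzv, hz'⟩
  · exact hcon (hΓ.colorable_of_third_missing hI h.rotate.rotate hw)
  obtain ⟨r, s, t, hr, hs, ht, e⟩ := h
  have hr' := Γ.symm _ _ _ hr
  have hs' := Γ.symm _ _ _ hs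
  have ht' := Γ.symm _ _ _ ht
  have hxy := hΓ.edge_of_negative_triangle hI hcon hr hs ht e hx hxv hxw hx' hy hyu hyw
    (fun b hb => by have := hy' b hb; tauto)
  have hyz := hΓ.edge_of_negative_triangle hI hcon hs ht' hr' (by rw [← e]; ac_rfl)
    hy hyw hyu hy' hz hzv hzu (fun b hb => by have := hz' b hb; tauto)
  have hxz := hΓ.edge_of_negative_triangle hI hcon ht hs' hr (by rw [← e]; ac_rfl)
    hx hxw hxv (fun b hb => by have := hx' b hb; tauto) hz hzu hzv hz'
  -- The three outer neighbours form a positive triangle.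
  refine hcon (hΓ.colorable_of_positive_triangle hI (u := x) (v := y) (w := z)
    ⟨_, _, _, hxy, hyz, hxz, ?_⟩)
  have key : ∀ α β γ r s t : ℤˣ, r * s * t = -1 →
      -(α * r * β) * -(β * s * γ) * -(α * t * γ) = 1 := by decide
  exact key α β γ r s t e

/-! ### Cycles of length four -/

theorem extend_square (hΓ : Γ.IsGood) {f : V → ZMod 10} {v₁ v₂ v₃ v₄ : V} {r s t u : ℤˣ}
    (hr : Γ.edge r v₁ v₂) (hs : Γ.edge s v₂ v₃) (ht : Γ.edge t v₃ v₄) (hu : Γ.edge u v₄ v₁)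
    (h₁₃ : v₁ ≠ v₃) (h₂₄ : v₂ ≠ v₄) (n₁₃ : ¬ Γ.Adj v₁ v₃) (n₂₄ : ¬ Γ.Adj v₂ v₄)
    (hf : Γ.IsColoringOff {v₁, v₂, v₃, v₄} f) {a b c d p q l m : ZMod 10}
    (ha : Γ.IsCenter f v₁ v₂ v₄ a) (hb : Γ.IsCenter f v₂ v₁ v₃ b)
    (hc : Γ.IsCenter f v₃ v₂ v₄ c) (hd : Γ.IsCenter f v₄ v₃ v₁ d)
    (hp : Within 2 p a) (hq : Within 2 q b) (hl : Within 2 l c) (hm : Within 2 m d)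
    (hpq : Within 2 p (q + off r)) (hql : Within 2 q (l + off s))
    (hlm : Within 2 l (m + off t)) (hmp : Within 2 m (p + off u)) : ∃ g, Γ.IsColoring g := by
  obtain ⟨g, rfl, rfl, rfl, rfl, hg⟩ := exists_recolor_four f (hΓ.ne ⟨r, hr⟩) h₁₃ (hΓ.ne ⟨s, hs⟩)
    (hΓ.ne ⟨u, hu⟩).symm h₂₄ (hΓ.ne ⟨t, ht⟩) p q l m
  refine ⟨g, isColoring_of_off hf hg ?_⟩
  have out : ∀ z, z = v₁ ∨ z = v₂ ∨ z = v₃ ∨ z = v₄ ∨ g z = f z := by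
    intro z
    by_cases hz : z ∈ ({v₁, v₂, v₃, v₄} : Set V)
    · simp only [Set.mem_insert_iff, Set.mem_singleton_iff] at hz
      tauto
    · exact Or.inr (Or.inr (Or.inr (Or.inr (hg z hz))))
  rintro y (rfl | rfl | rfl | rfl) e z he
  · have h₂ := fun e => (hΓ.within_of_edge (s := e) hr hpq).1
    have h₄ := fun e => (hΓ.within_of_edge (s := e) hu hmp).2
    rcases out z with rfl | rfl | rfl | rfl | hz
    · exact absurd he (hΓ.loopless _ _)
    · exact h₂ e he
    · exact absurd ⟨e, he⟩ n₁₃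
    · exact h₄ e he
    rcases ha _ hp z e he with rfl | rfl | h
    exacts [h₂ e he, h₄ e he, hz ▸ h]
  · have h₁ := fun e => (hΓ.within_of_edge (s := e) hr hpq).2
    have h₃ := fun e => (hΓ.within_of_edge (s := e) hs hql).1
    rcases out z with rfl | rfl | rfl | rfl | hz
    · exact h₁ e he
    · exact absurd he (hΓ.loopless _ _)
    · exact h₃ e he
    · exact absurd ⟨e, he⟩ n₂₄
    rcases hb _ hq z e he with rfl | rfl | h
    exacts [h₁ e he, h₃ e he, hz ▸ h]
  · have h₂ := fun e => (hΓ.within_of_edge (s := e) hs hql).2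
    have h₄ := fun e => (hΓ.within_of_edge (s := e) ht hlm).1
    rcases out z with rfl | rfl | rfl | rfl | hz
    · exact absurd (Adj.symm ⟨e, he⟩) n₁₃
    · exact h₂ e he
    · exact absurd he (hΓ.loopless _ _)
    · exact h₄ e he
    rcases hc _ hl z e he with rfl | rfl | h
    exacts [h₂ e he, h₄ e he, hz ▸ h]
  · have h₁ := fun e => (hΓ.within_of_edge (s := e) hu hmp).1
    have h₃ := fun e => (hΓ.within_of_edge (s := e) ht hlm).2
    rcases out z with rfl | rfl | rfl | rfl | hz
    · exact h₁ e he
    · exact absurd (Adj.symm ⟨e, he⟩) n₂₄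
    · exact h₃ e he
    · exact absurd he (hΓ.loopless _ _)
    rcases hd _ hm z e he with rfl | rfl | h
    exacts [h₃ e he, h₁ e he, hz ▸ h]

theorem colorable_of_negative_square (hΓ : Γ.IsGood) (hI : Γ.SmallerColorable)
    {v₁ v₂ v₃ v₄ : V} {r s t u : ℤˣ} (hr : Γ.edge r v₁ v₂) (hs : Γ.edge s v₂ v₃)
    (ht : Γ.edge t v₃ v₄) (hu : Γ.edge u v₄ v₁) (h₁₃ : v₁ ≠ v₃) (h₂₄ : v₂ ≠ v₄)
    (e : r * s * t * u = -1) : ∃ f, Γ.IsColoring f := by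
  by_contra hcon
  have a₁₂ : Γ.Adj v₁ v₂ := ⟨r, hr⟩
  have a₂₃ : Γ.Adj v₂ v₃ := ⟨s, hs⟩
  have a₃₄ : Γ.Adj v₃ v₄ := ⟨t, ht⟩
  have a₄₁ : Γ.Adj v₄ v₁ := ⟨u, hu⟩
  have n₁₃ : ¬ Γ.Adj v₁ v₃ := fun h => hcon (hΓ.colorable_of_triangle hI a₁₂ a₂₃ h)
  have n₂₄ : ¬ Γ.Adj v₂ v₄ := fun h => hcon (hΓ.colorable_of_triangle hI a₂₃ a₃₄ h)
  obtain ⟨f, hf⟩ := hΓ.exists_coloringOff hI (H := {v₁, v₂, v₃, v₄}) (by simp) a₁₂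
  obtain ⟨a, ha⟩ := hΓ.exists_isCenter f a₁₂ a₄₁.symm h₂₄
  obtain ⟨b, hb⟩ := hΓ.exists_isCenter f a₁₂.symm a₂₃ h₁₃
  obtain ⟨c, hc⟩ := hΓ.exists_isCenter f a₂₃.symm a₃₄ h₂₄
  obtain ⟨d, hd⟩ := hΓ.exists_isCenter f a₃₄.symm a₄₁ h₁₃.symm
  obtain ⟨p, q, l, m, hp, hq, hl, hm, hpq, hql, hlm, hmp⟩ := exists_negative_square a b c d e
  exact hcon (hΓ.extend_square hr hs ht hu h₁₃ h₂₄ n₁₃ n₂₄ hf ha hb hc hd hp hq hl hm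
    hpq hql hlm hmp)

theorem colorable_of_square (hΓ : Γ.IsGood) (hI : Γ.SmallerColorable) {v₁ v₂ v₃ v₄ : V}
    (a₁₂ : Γ.Adj v₁ v₂) (a₂₃ : Γ.Adj v₂ v₃) (a₃₄ : Γ.Adj v₃ v₄) (a₄₁ : Γ.Adj v₄ v₁)
    (h₁₃ : v₁ ≠ v₃) (h₂₄ : v₂ ≠ v₄) : ∃ f, Γ.IsColoring f := by
  by_contra hcon
  have tri : ∀ {a b c}, Γ.Adj a b → Γ.Adj b c → ¬ Γ.Adj a c :=
    fun h₁ h₂ h₃ => hcon (hΓ.colorable_of_triangle hI h₁ h₂ h₃)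
  obtain ⟨r, hr⟩ := id a₁₂
  obtain ⟨s, hs⟩ := id a₂₃
  obtain ⟨t, ht⟩ := id a₃₄
  obtain ⟨u, hu⟩ := id a₄₁
  have e : r * s * t * u = 1 := (Int.units_eq_one_or _).resolve_right
    fun e => hcon (hΓ.colorable_of_negative_square hI hr hs ht hu h₁₃ h₂₄ e)
  have n₁₃ := tri a₁₂ a₂₃
  have n₂₄ := tri a₂₃ a₃₄
  have done : ∀ f, Γ.IsColoringOff {v₁, v₂, v₃, v₄} f → ∀ a c, Γ.IsCenter f v₁ v₂ v₄ a →
      Γ.IsCenter f v₃ v₂ v₄ c → ¬ Within 3 a (c + off r + off s) := by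
    intro f hf a c ha hc hac
    obtain ⟨b, hb⟩ := hΓ.exists_isCenter f a₁₂.symm a₂₃ h₁₃
    obtain ⟨d, hd⟩ := hΓ.exists_isCenter f a₃₄.symm a₄₁ h₁₃.symm
    obtain ⟨p, q, l, m, hp, hq, hl, hm, hpq, hql, hlm, hmp⟩ :=
      exists_positive_square a b c d e hac
    exact hcon (hΓ.extend_square hr hs ht hu h₁₃ h₂₄ n₁₃ n₂₄ hf ha hb hc hd hp hq hl hm
      hpq hql hlm hmp)
  obtain ⟨f, hf⟩ := hΓ.exists_coloringOff hI (H := {v₁, v₂, v₃, v₄}) (by simp) a₁₂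
  rcases hΓ.third_neighbor a₁₂ a₄₁.symm h₂₄ with hv | ⟨x, α, hx, hx₂, hx₄, hx'⟩
  · obtain ⟨c, hc⟩ := hΓ.exists_isCenter f a₂₃.symm a₃₄ h₂₄
    exact done f hf _ c (fun _ _ z k hz => (hv z ⟨k, hz⟩).imp_right Or.inl) hc (within_self 3 _)
  rcases hΓ.third_neighbor a₂₃.symm a₃₄ h₂₄ with hv | ⟨y, γ, hy, hy₂, hy₄, hy'⟩
  · obtain ⟨a, ha⟩ := hΓ.exists_isCenter f a₁₂ a₄₁.symm h₂₄
    refine done f hf a (a + off r + off s) ha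
      (fun _ _ z k hz => (hv z ⟨k, hz⟩).imp_right Or.inl) ((within_self 3 a).of_sub_eq ?_)
    linear_combination off_add_self r + off_add_self s
  have a₁x : Γ.Adj v₁ x := ⟨α, hx⟩
  have a₃y : Γ.Adj v₃ y := ⟨γ, hy⟩
  -- The condition on the centres at `v₁` and `v₃`, as a condition on the colours of `x` and `y`.
  have done' : ∀ f, Γ.IsColoringOff {v₁, v₂, v₃, v₄} f →
      ¬ Within 3 (f x) (f y + off (α * r * s * γ)) := by
    intro f hf hxy
    refine done f hf _ _ (hΓ.isCenter f hx hx') (hΓ.isCenter f hy hy') (hxy.of_sub_eq ?_)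
    simp only [off_mul]
    linear_combination -off_add_self α
  have hxH : x ∉ ({v₁, v₂, v₃, v₄} : Set V) := by
    have : x ≠ v₃ := fun h => n₁₃ (h ▸ a₁x)
    simp [(hΓ.ne a₁x).symm, hx₂, this, hx₄]
  have hyH : y ∉ ({v₁, v₂, v₃, v₄} : Set V) := by
    have : y ≠ v₁ := fun h => n₁₃ (h ▸ a₃y).symm
    simp [(hΓ.ne a₃y).symm, hy₂, this, hy₄]
  by_cases hxy : x = y
  · subst hxy
    -- The cycle through `v₁`, `v₂`, `v₃`, `x` is positive as well.
    have e' : r * s * γ * α = 1 := (Int.units_eq_one_or _).resolve_right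
      fun e => hcon (hΓ.colorable_of_negative_square hI hr hs hy (Γ.symm _ _ _ hx) h₁₃
        hx₂.symm e)
    refine done' f hf ?_
    rw [show α * r * s * γ = 1 by rw [← e']; ac_rfl]
    simpa [off] using within_self 3 (f x)
  by_cases hadj : Γ.Adj x y
  · obtain ⟨k, hk⟩ := hadj
    by_cases hk' : k = α * r * s * γ
    · exact done' f hf (hk' ▸ (hf k x y hxH hyH hk).mono (by norm_num))
    -- The edge between `x` and `y` has the wrong sign. Apart from each other and from `v₁` and
    -- `v₃`, the vertices `x` and `y` have at most one neighbour each. So they can be recoloured to be just as far from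
    -- the condition for the right sign as a positive cycle of length four tolerates.
    have hkn : -k = α * r * s * γ := by rw [Int.units_ne_iff_eq_neg.1 hk', neg_neg]
    have axy : Γ.Adj x y := ⟨k, hk⟩
    obtain ⟨a, ha⟩ := hΓ.exists_isCenter f a₁x.symm axy fun h => n₁₃ (h ▸ a₃y).symm
    obtain ⟨c, hc⟩ := hΓ.exists_isCenter f a₃y.symm axy.symm fun h => n₁₃ (h ▸ a₁x)
    obtain ⟨p, q, hp, hq, hpq, hpq'⟩ := exists_edge_within_three a c k
    classical
    have gx : ∀ z, Function.update (Function.update f x p) y q z =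
      if z = y then q else if z = x then p else f z := by
      intro z
      simp only [Function.update_apply]
    refine done' (Function.update (Function.update f x p) y q) ?_ ?_
    · have key : ∀ i b z, b ∉ ({v₁, v₂, v₃, v₄} : Set V) → z ∉ ({v₁, v₂, v₃, v₄} : Set V) →
          Γ.edge i b z → b = x ∨ b = y →
          Within 2 (Function.update (Function.update f x p) y q b)
            (Function.update (Function.update f x p) y q z + off i) := by
        have hgxy : Within 2 (Function.update (Function.update f x p) y q x)
            (Function.update (Function.update f x p) y q y + off k) := by
          simpa [gx, hxy] using hpq
        rintro i b z - hz hi (rfl | rfl)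
        · by_cases hzy : z = y
          · subst hzy
            exact (hΓ.within_of_edge hk hgxy).1 hi
          have hzv : z ≠ v₁ := fun h => hz (by simp [h])
          have hzx : z ≠ b := fun h => hΓ.ne ⟨i, hi⟩ h.symm
          have := ((ha p hp z i hi).resolve_left hzv).resolve_left hzy
          simpa [gx, hxy, hzx, hzy] using this
        · by_cases hzx : z = x
          · subst hzx
            exact (hΓ.within_of_edge hk hgxy).2 hi
          have hzv : z ≠ v₃ := fun h => hz (by simp [h])
          have hzy : z ≠ b := fun h => hΓ.ne ⟨i, hi⟩ h.symm
          have := ((hc q hq z i hi).resolve_left hzv).resolve_left hzx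
          simpa [gx, hzx, hzy] using this
      intro i b z hb hz hi
      by_cases hb' : b = x ∨ b = y
      · exact key i b z hb hz hi hb'
      by_cases hz' : z = x ∨ z = y
      · exact (key i z b hz hb (Γ.symm _ _ _ hi) hz').off_symm
      rw [not_or] at hb' hz'
      simpa [gx, hb'.1, hb'.2, hz'.1, hz'.2] using hf i b z hb hz hi
    · rw [← hkn]
      simpa [gx, hxy] using hpq'
  · obtain ⟨f, hf, h⟩ := hΓ.exists_coloringOff_rewire hI (α * r * s * γ) hxH hyH hxy hadj
      (h := v₁) (by simp) a₁x.symm (k := v₃) (by simp) a₃y.symm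
      (fun p q hpq h₁ h₂ _ _ => tri h₁ hpq h₂)
    exact done' f hf (h.mono (by norm_num))

end IsGood

/-! ### Girth at least five -/

/-- The vertex `w` and its neighbours. -/
def closedNeighborSet (Γ : SignedGraph V) (w : V) : Set V := {x | x = w ∨ Γ.Adj w x}

/-- All edges at `w` and its neighbours are deleted, and for each neighbour `u` of `w` an edge
between the other two neighbours of `u` is added, whose sign is the product of the signs of the
path through `u`. -/
def contractStar (Γ : SignedGraph V) (w : V) : SignedGraph V where
  edge s a b := (a ∉ Γ.closedNeighborSet w ∧ b ∉ Γ.closedNeighborSet w ∧ Γ.edge s a b) ∨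
    (a ≠ b ∧ a ≠ w ∧ b ≠ w ∧ ∃ u r t, Γ.Adj w u ∧ Γ.edge r u a ∧ Γ.edge t u b ∧ s = r * t)
  symm := by
    rintro s a b (⟨h₁, h₂, h₃⟩ | ⟨h₁, h₂, h₃, u, r, t, h₄, h₅, h₆, h₇⟩)
    · exact Or.inl ⟨h₂, h₁, Γ.symm _ _ _ h₃⟩
    · exact Or.inr ⟨h₁.symm, h₃, h₂, u, t, r, h₄, h₆, h₅, h₇.trans (mul_comm _ _)⟩

namespace IsGood

theorem eq_of_adj_adj (hΓ : Γ.IsGood) {u a b c d : V} (ha : Γ.Adj u a) (hb : Γ.Adj u b)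
    (hc : Γ.Adj u c) (hd : Γ.Adj u d) (hab : a ≠ b) (hca : c ≠ a) (hcb : c ≠ b) (hda : d ≠ a)
    (hdb : d ≠ b) : c = d := by
  rcases hΓ.third_neighbor ha hb hab with h | ⟨x, -, -, -, -, h⟩
  · exact ((h c hc).elim hca hcb).elim
  · exact (((h c hc).resolve_left hca).resolve_left hcb).trans
      (((h d hd).resolve_left hda).resolve_left hdb).symm

/-- In girth at least five the edges that are added form a matching, since the neighbours of `w`
have no common neighbour other than `w`. Therefore they neither become parallel nor create a
`(K₄, -)`: removing a matching from `K₄` leaves a cycle of length four. -/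
theorem contractStar (hΓ : Γ.IsGood)
    (tri : ∀ {a b c}, Γ.Adj a b → Γ.Adj b c → ¬ Γ.Adj a c)
    (sq : ∀ {a b c d}, Γ.Adj a b → Γ.Adj b c → Γ.Adj c d → Γ.Adj d a → a ≠ c → b = d) (w : V) :
    (Γ.contractStar w).IsGood where
  loopless := by
    rintro s v (h | h)
    · exact hΓ.loopless _ _ h.2.2
    · exact h.1 rfl
  simple := by
    rintro s s' a b (h | ⟨-, ha, hb, u, r, t, hu, hr, ht, rfl⟩)
      (h' | ⟨-, ha', hb', u', r', t', hu', hr', ht', rfl⟩)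
    · exact hΓ.simple _ _ _ _ h.2.2 h'.2.2
    · exact (tri ⟨_, Γ.symm _ _ _ hr'⟩ ⟨_, ht'⟩ ⟨_, h.2.2⟩).elim
    · exact (tri ⟨_, Γ.symm _ _ _ hr⟩ ⟨_, ht⟩ ⟨_, h'.2.2⟩).elim
    · obtain rfl : u = u' := sq hu ⟨r, hr⟩ (Adj.symm ⟨r', hr'⟩) hu'.symm ha.symm
      rw [hΓ.simple _ _ _ _ hr hr', hΓ.simple _ _ _ _ ht ht']
  subcubic v := by
    -- A deleted neighbour `e` of `v` is replaced by the third neighbour of `e`.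
    have hslot : ∀ e, ∃ e', ∀ d, Γ.Adj v e →
        (d = e ∧ e ∉ Γ.closedNeighborSet w ∨ Γ.Adj w e ∧ Γ.Adj e d ∧ d ≠ v ∧ d ≠ w ∧ v ≠ w) →
        d = e' := by
      intro e
      by_cases he : Γ.Adj w e
      · by_cases hd : ∃ d, Γ.Adj e d ∧ d ≠ v ∧ d ≠ w
        · obtain ⟨d, hd, hdv, hdw⟩ := hd
          refine ⟨d, ?_⟩
          rintro d' hve (⟨-, h⟩ | ⟨-, h, hdv', hdw', hvw⟩)
          · exact absurd (Or.inr he) h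
          · exact hΓ.eq_of_adj_adj hve.symm he.symm h hd hvw hdv' hdw' hdv hdw
        · refine ⟨e, ?_⟩
          rintro d' - (⟨-, h⟩ | ⟨-, h, hdv', hdw', -⟩)
          · exact absurd (Or.inr he) h
          · exact absurd ⟨d', h, hdv', hdw'⟩ hd
      · exact ⟨e, fun d _ h => h.elim And.left fun h => absurd h.1 he⟩
    choose φ hφ using hslot
    obtain ⟨x, y, z, hv⟩ := hΓ.subcubic v
    have key : ∀ d, (Γ.contractStar w).Adj v d → ∃ e, Γ.Adj v e ∧ d = φ e := by
      rintro d ⟨s, h | ⟨hvd, hvw, hdw, u, r, t, hu, hr, ht, -⟩⟩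
      · exact ⟨d, ⟨s, h.2.2⟩, hφ d d ⟨s, h.2.2⟩ (Or.inl ⟨rfl, h.2.1⟩)⟩
      · exact ⟨u, Adj.symm ⟨r, hr⟩, hφ u d (Adj.symm ⟨r, hr⟩)
          (Or.inr ⟨hu, ⟨t, ht⟩, hvd.symm, hdw, hvw⟩)⟩
    refine ⟨φ x, φ y, φ z, fun d hd => ?_⟩
    obtain ⟨e, he, rfl⟩ := key d hd
    rcases hv e he with rfl | rfl | rfl <;> simp
  not_negK4 := by
    -- `N` is the relation of being joined by an additional edge, which is a matching.
    let N : V → V → Prop := fun a b =>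
      a ≠ b ∧ a ≠ w ∧ b ≠ w ∧ ∃ u, Γ.Adj w u ∧ Γ.Adj u a ∧ Γ.Adj u b
    have nsymm : ∀ {a b}, N a b → N b a :=
      fun ⟨h₁, h₂, h₃, u, h₄, h₅, h₆⟩ => ⟨h₁.symm, h₃, h₂, u, h₄, h₆, h₅⟩
    have match' : ∀ {a b c}, N a b → N a c → b = c := by
      rintro a b c ⟨hab, ha, hb, u, hu, hua, hub⟩ ⟨hac, -, hc, u', hu', hua', huc⟩
      obtain rfl : u = u' := sq hu hua hua'.symm hu'.symm ha.symm
      exact hΓ.eq_of_adj_adj hua hu.symm hub huc ha hab.symm hb hac.symm hc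
    have cases' : ∀ {a b}, (Γ.contractStar w).Adj a b → Γ.Adj a b ∨ N a b := by
      rintro a b ⟨s, h | ⟨h₁, h₂, h₃, u, r, t, hu, hr, ht, -⟩⟩
      · exact Or.inl ⟨s, h.2.2⟩
      · exact Or.inr ⟨h₁, h₂, h₃, u, hu, ⟨r, hr⟩, ⟨t, ht⟩⟩
    have tadj : ∀ {u v x}, (Γ.contractStar w).Triangle (-1) u v x →
        (Γ.contractStar w).Adj u v ∧ (Γ.contractStar w).Adj v x ∧ (Γ.contractStar w).Adj u x :=
      fun ⟨r, s, t, hr, hs, ht, _⟩ => ⟨⟨r, hr⟩, ⟨s, hs⟩, ⟨t, ht⟩⟩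
    have ne' : ∀ {a b}, (Γ.contractStar w).Adj a b → a ≠ b :=
      fun h => (cases' h).elim hΓ.ne And.left
    rintro a b c d ⟨h₁, h₂, h₃, -⟩
    obtain ⟨ab, bc, ac⟩ := tadj h₁
    obtain ⟨-, bd, ad⟩ := tadj h₂
    obtain ⟨-, cd, -⟩ := tadj h₃
    have old : ∀ {x y z}, N x y → (Γ.contractStar w).Adj x z → y ≠ z → Γ.Adj x z :=
      fun h h' n => (cases' h').resolve_right fun h'' => n (match' h h'')
    rcases cases' ab with hab | hab
    · rcases cases' ac with hac | hac
      · have hbc : N b c := (cases' bc).resolve_left fun h => tri hab h hac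
        have e₁ := old hbc bd (ne' cd)
        have e₂ := old (nsymm hbc) cd (ne' bd)
        exact ne' bc (sq hab e₁ e₂.symm hac.symm (ne' ad))
      · have e₁ := old hac ad (ne' cd)
        have e₂ := old (nsymm hac) (Adj.symm bc) (ne' ab)
        have e₃ := old (nsymm hac) cd (ne' ad)
        exact ne' bd (sq hab e₂.symm e₃ e₁.symm (ne' ac))
    · have e₁ := old hab ac (ne' bc)
      have e₂ := old hab ad (ne' bd)
      have e₃ := old (nsymm hab) bc (ne' ac)
      have e₄ := old (nsymm hab) bd (ne' ad)
      exact ne' cd (sq e₁ e₃.symm e₄ e₂.symm (ne' ab))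

/-- A neighbour `u` of `w` excludes at most three colours of `w`. -/
theorem exists_center_of_contractStar (hΓ : Γ.IsGood) {f : V → ZMod 10} {w u : V}
    (hf : (Γ.contractStar w).IsColoring f) {s : ℤˣ} (hs : Γ.edge s w u) :
    ∃ m, ∀ p, Within 3 p m → ∃ q, Within 2 p (q + off s) ∧
      ∀ b k, Γ.edge k u b → b ≠ w → Within 2 q (f b + off k) := by
  have hu : Γ.Adj u w := Adj.symm ⟨s, hs⟩
  obtain ⟨a, b, hab, hq⟩ : ∃ a b, Within 2 a b ∧ ∀ q, Within 2 q a → Within 2 q b →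
      ∀ b k, Γ.edge k u b → b ≠ w → Within 2 q (f b + off k) := by
    by_cases hx : ∃ x r, Γ.edge r u x ∧ x ≠ w
    · obtain ⟨x, r, hx, hxw⟩ := hx
      rcases hΓ.third_neighbor hu ⟨r, hx⟩ hxw.symm with h | ⟨y, t, hy, hyw, hyx, h⟩
      · refine ⟨f x + off r, f x + off r, within_self _ _, fun q hq _ b k hk hb => ?_⟩
        obtain rfl := (h b ⟨k, hk⟩).resolve_left hb
        rwa [hΓ.simple _ _ _ _ hk hx]
      · refine ⟨f x + off r, f y + off t, ?_, fun q hqx hqy b k hk hb => ?_⟩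
        · have := hf (r * t) x y (Or.inr ⟨hyx.symm, hxw, hyw, u, r, t, hu.symm, hx, hy, rfl⟩)
          refine this.of_sub_eq ?_
          rw [off_mul]
          linear_combination -off_add_self r
        · rcases (h b ⟨k, hk⟩).resolve_left hb with rfl | rfl
          · rwa [hΓ.simple _ _ _ _ hk hx]
          · rwa [hΓ.simple _ _ _ _ hk hy]
    · exact ⟨0, 0, within_self _ _, fun q _ _ b k hk hb => absurd ⟨b, k, hk, hb⟩ hx⟩
  obtain ⟨m, hm⟩ := exists_center_of_within_two hab
  refine ⟨m + off s, fun p hp => ?_⟩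
  obtain ⟨q, h₁, h₂, h₃⟩ := hm (p + off s) (hp.off_symm.symm)
  exact ⟨q, h₁.symm.off_symm, hq q h₂ h₃⟩

theorem colorable_of_girth (hΓ : Γ.IsGood) (hI : Γ.SmallerColorable)
    (tri : ∀ {a b c}, Γ.Adj a b → Γ.Adj b c → ¬ Γ.Adj a c)
    (sq : ∀ {a b c d}, Γ.Adj a b → Γ.Adj b c → Γ.Adj c d → Γ.Adj d a → a ≠ c → b = d)
    {w u : V} (hwu : Γ.Adj w u) : ∃ f, Γ.IsColoring f := by
  classical
  obtain ⟨f, hf⟩ := hI (Γ.contractStar w) (hΓ.contractStar tri sq w) (by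
    refine ⟨?_, fun h => ?_⟩
    · rintro a ⟨b, s, h | ⟨-, -, -, u, r, t, -, hr, -⟩⟩
      · exact ⟨b, s, h.2.2⟩
      · exact ⟨u, r, Γ.symm _ _ _ hr⟩
    · obtain ⟨b, s, h | h⟩ := h (show w ∈ Γ.support from ⟨u, hwu⟩)
      · exact h.1 (Or.inl rfl)
      · exact h.2.1 rfl)
  have hm : ∀ u, ∃ m, Γ.Adj w u → ∀ p, Within 3 p m → ∃ q,
      (∀ s, Γ.edge s w u → Within 2 p (q + off s)) ∧
      ∀ b k, Γ.edge k u b → b ≠ w → Within 2 q (f b + off k) := by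
    intro u
    by_cases hu : Γ.Adj w u
    · obtain ⟨s, hs⟩ := hu
      obtain ⟨m, hm⟩ := hΓ.exists_center_of_contractStar hf hs
      refine ⟨m, fun _ p hp => ?_⟩
      obtain ⟨q, h₁, h₂⟩ := hm p hp
      exact ⟨q, fun s' hs' => hΓ.simple _ _ _ _ hs hs' ▸ h₁, h₂⟩
    · exact ⟨0, fun h => absurd h hu⟩
  choose m hm using hm
  obtain ⟨x, y, z, hw⟩ := hΓ.subcubic w
  obtain ⟨p, hx, hy, hz⟩ := exists_within_three (m x) (m y) (m z)
  have hq : ∀ u, ∃ q, Γ.Adj w u → (∀ s, Γ.edge s w u → Within 2 p (q + off s)) ∧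
      ∀ b k, Γ.edge k u b → b ≠ w → Within 2 q (f b + off k) := by
    intro u
    by_cases hu : Γ.Adj w u
    · obtain ⟨q, h⟩ := hm u hu p (by rcases hw u hu with rfl | rfl | rfl <;> assumption)
      exact ⟨q, fun _ => h⟩
    · exact ⟨0, fun h => absurd h hu⟩
  choose q hq using hq
  refine ⟨fun v => if v = w then p else if Γ.Adj w v then q v else f v,
    isColoring_of_off (H := Γ.closedNeighborSet w) (f := f)
      (fun s a b ha hb h => hf s a b (Or.inl ⟨ha, hb, h⟩)) ?_ ?_⟩
  · intro v hv
    simp only [closedNeighborSet, Set.mem_ofPred_eq, not_or] at hv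
    simp [hv.1, hv.2]
  · rintro v (rfl | hv) s b hb
    · have hvb : Γ.Adj v b := ⟨s, hb⟩
      simpa [hvb, (hΓ.ne hvb).symm] using (hq b hvb).1 s hb
    · have hvw : v ≠ w := (hΓ.ne hv).symm
      by_cases hbw : b = w
      · subst hbw
        simpa [hvw, hv] using ((hq v hv).1 s (Γ.symm _ _ _ hb)).off_symm
      · have hwb : ¬ Γ.Adj w b := tri hv ⟨s, hb⟩
        simpa [hvw, hv, hbw, hwb] using (hq v hv).2 b s hb hbw

/-- Every signed simple graph of maximum degree at most three without `(K₄, -)` has a circular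
`10/3`-colouring. -/
theorem exists_isColoring [Finite V] (hΓ : Γ.IsGood) : ∃ f, Γ.IsColoring f := by
  induction hS : Γ.support using WellFoundedLT.induction generalizing Γ with
  | ind S ih =>
    subst hS
    have hI : Γ.SmallerColorable := fun Δ hΔ hlt => ih _ hlt hΔ rfl
    by_contra hcon
    have tri : ∀ {a b c}, Γ.Adj a b → Γ.Adj b c → ¬ Γ.Adj a c :=
      fun h₁ h₂ h₃ => hcon (hΓ.colorable_of_triangle hI h₁ h₂ h₃)
    have sq : ∀ {a b c d}, Γ.Adj a b → Γ.Adj b c → Γ.Adj c d → Γ.Adj d a → a ≠ c → b = d :=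
      fun h₁ h₂ h₃ h₄ h₅ => by_contra fun h₆ => hcon (hΓ.colorable_of_square hI h₁ h₂ h₃ h₄ h₅ h₆)
    by_cases h : ∃ w u, Γ.Adj w u
    · obtain ⟨w, u, h⟩ := h
      exact hcon (hΓ.colorable_of_girth hI tri sq h)
    · exact hcon ⟨0, fun s u v e => absurd ⟨u, v, s, e⟩ h⟩

end IsGood

/-! ### Components, switching isomorphism and the signed circular clique -/

/-- Switching at the vertices joined to `a` by a positive edge makes all edges of a `K₄` with
negative triangles negative. -/
theorem switchingIsomorphic_negComplete (hl : ∀ s v, ¬ Γ.edge s v v)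
    (hs : ∀ s t u v, Γ.edge s u v → Γ.edge t u v → s = t) {a b c d : V} (h : Γ.NegK4 a b c d)
    {S : Set V} (hS : ∀ x, x ∈ S ↔ x = a ∨ x = b ∨ x = c ∨ x = d) :
    (Γ.induce S).SwitchingIsomorphic (negComplete 4) := by
  -- After switching `X`, an edge `uv` disjoint from `a` has the sign of the triangle `auv`.
  let X : Set V := {v | Γ.edge 1 a v}
  have haX : a ∉ X := hl 1 a
  have hX : ∀ {r v}, Γ.edge r a v → (v ∈ X ↔ r = 1) := fun hr =>
    ⟨fun h => hs _ _ _ _ hr h, fun h => show Γ.edge 1 a _ from h ▸ hr⟩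
  have base : ∀ {r v}, Γ.edge r a v → (Γ.switch X).edge (-1) a v := by
    intro r v hr
    rcases Int.units_eq_one_or r with rfl | rfl
    · exact Or.inr ⟨by simp [haX, (hX hr).2 rfl], by simpa using hr⟩
    · exact Or.inl ⟨by simp [haX, hX hr], hr⟩
  have side : ∀ {u v}, Γ.Triangle (-1) a u v → (Γ.switch X).edge (-1) u v := by
    rintro u v ⟨r, s, t, hr, hs, ht, e⟩
    rcases Int.units_eq_one_or r with rfl | rfl <;> rcases Int.units_eq_one_or t with rfl | rfl
    · exact Or.inl ⟨by simp [hX hr, hX ht], by simp_all⟩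
    · exact Or.inr ⟨by simp [hX hr, hX ht], by simp_all⟩
    · exact Or.inr ⟨by simp [hX hr, hX ht], by simp_all⟩
    · exact Or.inl ⟨by simp [hX hr, hX ht], by simp_all⟩
  have hl' : ∀ s v, ¬ (Γ.switch X).edge s v v := by
    rintro s v (h | h)
    exacts [hl _ _ h.2, hl _ _ h.2]
  have hs' : ∀ s t u v, (Γ.switch X).edge s u v → (Γ.switch X).edge t u v → s = t := by
    rintro s t u v (h | h) (h' | h')
    · exact hs _ _ _ _ h.2 h'.2
    · exact absurd h.1 h'.1
    · exact absurd h'.1 h.1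
    · exact neg_injective (hs _ _ _ _ h.2 h'.2)
  have ab : (Γ.switch X).edge (-1) a b := by
    obtain ⟨r, s, t, hr, -⟩ := h.1
    exact base hr
  have ac : (Γ.switch X).edge (-1) a c := by
    obtain ⟨r, s, t, -, -, ht, -⟩ := h.1
    exact base ht
  have ad : (Γ.switch X).edge (-1) a d := by
    obtain ⟨r, s, t, -, -, ht, -⟩ := h.2.1
    exact base ht
  have bc := side h.1
  have bd := side h.2.1
  have cd := side h.2.2.1
  let g : Fin 4 → S := ![⟨a, (hS a).2 (by simp)⟩, ⟨b, (hS b).2 (by simp)⟩,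
    ⟨c, (hS c).2 (by simp)⟩, ⟨d, (hS d).2 (by simp)⟩]
  have hg : ∀ i j, i ≠ j → (Γ.switch X).edge (-1) (g i) (g j) := by
    have sy := (Γ.switch X).symm (-1)
    intro i j hij
    fin_cases i <;> fin_cases j <;>
      first | exact absurd rfl hij | assumption | (apply sy; assumption)
  have hbij : Function.Bijective g := by
    refine ⟨fun i j hij => by_contra fun hne => ?_, fun ⟨x, hx⟩ => ?_⟩
    · have := hg i j hne
      rw [hij] at this
      exact hl' _ _ this
    · rcases (hS x).1 hx with rfl | rfl | rfl | rfl
      exacts [⟨0, rfl⟩, ⟨1, rfl⟩, ⟨2, rfl⟩, ⟨3, rfl⟩]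
  refine ⟨Subtype.val ⁻¹' X, (Equiv.ofBijective g hbij).symm, fun s u v => ?_⟩
  obtain ⟨i, rfl⟩ := (Equiv.ofBijective g hbij).surjective u
  obtain ⟨j, rfl⟩ := (Equiv.ofBijective g hbij).surjective v
  rw [Equiv.symm_apply_apply, Equiv.symm_apply_apply]
  change (Γ.switch X).edge s (g i) (g j) ↔ ∃ _ : i ≠ j, -1 = s
  constructor
  · intro he
    have hij : i ≠ j := by
      rintro rfl
      exact hl' _ _ he
    exact ⟨hij, hs' _ _ _ _ (hg i j hij) he⟩
  · rintro ⟨hij, rfl⟩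
    exact hg i j hij

theorem ofSimple_adj {G : SimpleGraph V} {σ : G.edgeSet → ℤˣ} {u v : V} :
    (ofSimple G σ).Adj u v ↔ G.Adj u v :=
  ⟨fun ⟨_, h, _⟩ => h, fun h => ⟨_, h, rfl⟩⟩

theorem exists_cover_of_maxDegree_le [Fintype V] {G : SimpleGraph V} [DecidableRel G.Adj]
    (h : G.maxDegree ≤ 3) (v : V) : ∃ x y z, ∀ b, G.Adj v b → b = x ∨ b = y ∨ b = z := by
  classical
  have hcard : (G.neighborFinset v).card ≤ 3 := (G.degree_le_maxDegree v).trans h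
  obtain ⟨t, ht, htc⟩ : ∃ t : Multiset V, (G.neighborFinset v).val ≤ t ∧ t.card = 3 :=
    ⟨(G.neighborFinset v).val + Multiset.replicate (3 - (G.neighborFinset v).card) v,
      Multiset.le_add_right _ _, by
        rw [Multiset.card_add, Multiset.card_replicate, Finset.card_val]
        omega⟩
  obtain ⟨x, y, z, rfl⟩ := Multiset.card_eq_three.1 htc
  refine ⟨x, y, z, fun b hb => ?_⟩
  have := Multiset.mem_of_le ht (Finset.mem_def.1 ((G.mem_neighborFinset v b).2 hb))
  simpa using this

/-- In a graph of maximum degree at most three, a `K₄` is a component. -/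
theorem isGood_ofSimple [Fintype V] {G : SimpleGraph V} [DecidableRel G.Adj]
    {σ : G.edgeSet → ℤˣ} (h : G.maxDegree ≤ 3)
    (hC : ∀ C : G.ConnectedComponent,
      ¬ ((ofSimple G σ).induce C.supp).SwitchingIsomorphic (negComplete 4)) :
    (ofSimple G σ).IsGood := by
  have hl : ∀ s v, ¬ (ofSimple G σ).edge s v v := fun _ _ ⟨h, _⟩ => G.loopless.irrefl _ h
  have hs : ∀ s t u v, (ofSimple G σ).edge s u v → (ofSimple G σ).edge t u v → s = t := by
    rintro s t u v ⟨_, rfl⟩ ⟨_, rfl⟩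
    rfl
  refine ⟨hl, hs, fun v => ?_, fun a b c d hK => ?_⟩
  · obtain ⟨x, y, z, hv⟩ := exists_cover_of_maxDegree_le h v
    exact ⟨x, y, z, fun b hb => hv b (ofSimple_adj.1 hb)⟩
  · have tadj : ∀ {u v w}, (ofSimple G σ).Triangle (-1) u v w →
        G.Adj u v ∧ G.Adj v w ∧ G.Adj u w :=
      fun ⟨_, _, _, ⟨hr, _⟩, ⟨hs, _⟩, ⟨ht, _⟩, _⟩ => ⟨hr, hs, ht⟩
    obtain ⟨ab, bc, ac⟩ := tadj hK.1
    obtain ⟨-, bd, ad⟩ := tadj hK.2.1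
    obtain ⟨-, cd, -⟩ := tadj hK.2.2.1
    have full : ∀ {u x y z v}, G.Adj u x → G.Adj u y → G.Adj u z → G.Adj x y → G.Adj x z →
        G.Adj y z → G.Adj u v → v = x ∨ v = y ∨ v = z := by
      intro u x y z v hx hy hz hxy hxz hyz hv
      obtain ⟨p, q, r, hu⟩ := exists_cover_of_maxDegree_le h u
      have h₁ := hu x hx
      have h₂ := hu y hy
      have h₃ := hu z hz
      have h₄ := hu v hv
      have n₁ := hxy.ne
      have n₂ := hxz.ne
      have n₃ := hyz.ne
      clear hu
      grind
    refine hC (G.connectedComponentMk a) (switchingIsomorphic_negComplete hl hs hK fun x => ?_)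
    rw [SimpleGraph.ConnectedComponent.mem_supp_iff, SimpleGraph.ConnectedComponent.eq]
    constructor
    · intro hx
      obtain ⟨p⟩ := hx.symm
      have walk : ∀ {u v : V}, G.Walk u v → (u = a ∨ u = b ∨ u = c ∨ u = d) →
          (v = a ∨ v = b ∨ v = c ∨ v = d) := by
        intro u v p
        induction p with
        | nil => exact id
        | cons huv _ ih =>
          rintro (rfl | rfl | rfl | rfl)
          · exact ih (Or.inr (full ab ac ad bc bd cd huv))
          · have := full ab.symm bc bd ac ad cd huv
            exact ih (by tauto)
          · have := full ac.symm bc.symm cd ab ad bd huv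
            exact ih (by tauto)
          · have := full ad.symm bd.symm cd.symm ab ac bc huv
            exact ih (by tauto)
      exact walk p (Or.inl rfl)
    · rintro (rfl | rfl | rfl | rfl)
      exacts [SimpleGraph.Reachable.refl _, ab.symm.reachable, ac.symm.reachable,
        ad.symm.reachable]

/-- The signed circular clique `K^s_{10;3}` consists of the colouring conditions on `ZMod 10`. -/
theorem circularClique_edge_of_within {s : ℤˣ} {p q : ZMod 10} (h : Within 2 p (q + off s)) :
    (circularClique 10 3).edge s p q := by
  have key : ∀ (s : ℤˣ) (p q : ZMod 10), Within 2 p (q + off s) →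
      (s = -1 ∧ ((3 : ℕ) : ℤ) ≤ |(p.val : ℤ) - (q.val : ℤ)| ∧
        |(p.val : ℤ) - (q.val : ℤ)| ≤ ((10 : ℕ) : ℤ) - ((3 : ℕ) : ℤ)) ∨
      (s = 1 ∧ (|(p.val : ℤ) - (q.val : ℤ)| ≤ ((10 : ℕ) : ℤ) / 2 - ((3 : ℕ) : ℤ) ∨
        ((10 : ℕ) : ℤ) / 2 + ((3 : ℕ) : ℤ) ≤ |(p.val : ℤ) - (q.val : ℤ)|)) := by
    decide +kernel
  exact key s p q h

theorem IsColoring.admitsCircularColoring {f : V → ZMod 10} (hf : Γ.IsColoring f) :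
    Γ.AdmitsCircularColoring 10 3 :=
  ⟨by norm_num, by decide, by norm_num, f,
    fun s u v h => circularClique_edge_of_within (hf s u v h)⟩

/-- A switching isomorphism is insensitive to passing to the subgraph induced by all vertices. -/
theorem SwitchingIsomorphic.of_induce {W : Type*} {Λ : SignedGraph W} {S : Set V}
    (hS : ∀ x, x ∈ S) (h : (Γ.induce S).SwitchingIsomorphic Λ) : Γ.SwitchingIsomorphic Λ := by
  obtain ⟨X, f, hf⟩ := h
  refine ⟨{v | (⟨v, hS v⟩ : S) ∈ X}, (Equiv.subtypeUnivEquiv hS).symm.trans f, fun s u v => ?_⟩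
  exact hf s ⟨u, hS u⟩ ⟨v, hS v⟩

end SignedGraph

theorem mainTheorem2 {V : Type*} [Fintype V] (G : SimpleGraph V) [DecidableRel G.Adj]
    (σ : G.edgeSet → ℤˣ) :
    (G.Connected → G.maxDegree = 3 →
      ¬ (SignedGraph.ofSimple G σ).SwitchingIsomorphic (SignedGraph.negComplete 4) →
      (SignedGraph.ofSimple G σ).circularChromaticNumber ≤ 10 / 3) ∧
    (G.maxDegree ≤ 3 →
      (∀ C : G.ConnectedComponent,
        ¬ ((SignedGraph.ofSimple G σ).induce C.supp).SwitchingIsomorphic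
          (SignedGraph.negComplete 4)) →
      (SignedGraph.ofSimple G σ).AdmitsCircularColoring 10 3) := by
  have main : G.maxDegree ≤ 3 →
      (∀ C : G.ConnectedComponent,
        ¬ ((SignedGraph.ofSimple G σ).induce C.supp).SwitchingIsomorphic
          (SignedGraph.negComplete 4)) →
      (SignedGraph.ofSimple G σ).AdmitsCircularColoring 10 3 := by
    intro h hC
    obtain ⟨f, hf⟩ := (SignedGraph.isGood_ofSimple h hC).exists_isColoring
    exact hf.admitsCircularColoring
  refine ⟨fun hG h hK => ?_, main⟩
  have hcol := main h.le fun C hC => hK (hC.of_induce fun x => by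
    obtain ⟨y, rfl⟩ := C.exists_rep
    exact SimpleGraph.ConnectedComponent.sound (hG.preconnected x y))
  exact sInf_le ⟨10, 3, hcol, by norm_num⟩
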